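/- Let $L_{REV}=\{uu^rvv^r : u,v\in\{0,1\}^*,\ u,v \text{ non-empty}\}$, where $u^r$ is the reverse of $u$. For an integer $n\ge 1$ and a real $0<\varepsilon<1$, let $\mathrm{REV}_{n,\varepsilon}$ be the following promise problem: given $x=(x_0,\dots,x_{n-1})\in\{0,1\}^n$ such that either $x\in L_{REV}$, or $|\{t: x_t\ne y_t\}|\ge\varepsilon n$ for every $y\in L_{REV}$ of length $n$, decide whether $x\in L_{REV}$. The input is accessed through the quantum query unitary $|i\rangle|z\rangle|w\rangle\mapsto|i\rangle|z\oplus x_i\rangle|w\rangle$. A quantum query algorithm alternates queries with unitaries that do not depend on $x$, and ends with a measurement. It may use a random seed, which is drawn before it starts. Its query complexity is the maximal number of queries over all seeds. Let $L=\lfloor n^{1/3}\rfloor$, $I_n=\{0,\dots,L-1\}$, $J_n=\{\alpha L: 0\le\alpha\le\lfloor n/L\rfloor\}$ and $m=\lceil\frac2\varepsilon\log_2 n\rceil$. The meet-in-the-middle algorithm works as follows. 1. It draws $p_1,\dots,p_m$ independently and uniformly from $\{0,\dots,n-1\}$. 2. It queries and stores the strings $x^i=(x_{(i-p_1)\bmod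 n},\dots,x_{(i-p_m)\bmod n})$ for all $i\in I_n$ (in a trie). 3. It uses Grover search over $j\in J_n$ for the predicate "there is $i\in I_n$ such that $\tilde x^j=x^i$ and $i+j=2k-1$ for some integers $k,l\ge1$ with $2k+2l=n$", where $\tilde x^j=(x_{(j+p_1)\bmod n},\dots,x_{(j+p_m)\bmod n})$. It answers "$x\in L_{REV}$" if and only if the search finds such a $j$. Here Grover search consists of $9$ repetitions. Each repetition draws a number $r$ uniformly from $\{0,\dots,\lceil\sqrt{|J_n|}\rceil-1\}$, performs $r$ Grover iterations from the uniform superposition over $J_n$, and checks the predicate for the resulting $j$. All measurements are made at the end. **Theorem.** There is an absolute constant $C$ such that for all $n\ge1$ and $0<\varepsilon<1$, the meet-in-the-middle algorithm has query complexity at most $C\cdot\frac1\varepsilon n^{1/3}\log n$, and on every input that satisfies the promise of $\mathrm{REV}_{n,\varepsilon}$ it gives the wrong answer with probability at most $\frac14$. -/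

import Mathlib

open scoped Matrix

/-! ### The language and the property-testing problem -/

/-- The language of words `u uʳ v vʳ` with `u`, `v` non-empty words over the binary alphabet. -/
def LRev : Language Bool :=
  {w | ∃ u v : List Bool, u ≠ [] ∧ v ≠ [] ∧ w = u ++ u.reverse ++ v ++ v.reverse}

open Classical in
/-- `REV n x = true` iff the word `x₀ … x_{n-1}` belongs to `LRev`. -/
noncomputable def REV (n : ℕ) (x : Fin n → Bool) : Bool := decide (List.ofFn x ∈ LRev)

/-- The promise of the property-testing problem: an input outside `LRev` differs in at least
`ε n` positions from every word of length `n` in `LRev`. -/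
def RevPromise (n : ℕ) (ε : ℝ) (x : Fin n → Bool) : Prop :=
  List.ofFn x ∉ LRev →
    ∀ u : Fin n → Bool, List.ofFn u ∈ LRev → ε * n ≤ (hammingDist x u : ℝ)

/-! ### The quantum query model -/

/-- Computational basis `|i⟩|z⟩|w⟩`: an index `i` of an input variable, an output bit `z`, and
a work space `w`. -/
abbrev QBasis (n : ℕ) (W : Type) : Type := Fin n × Bool × W

/-- The query unitary `|i⟩|z⟩|w⟩ ↦ |i⟩|z ⊕ xᵢ⟩|w⟩` acting on amplitude vectors. (The basis map is
its own inverse, so the new amplitude at `|i, z, w⟩` is the old one at `|i, z ⊕ xᵢ, w⟩`.) -/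
def queryUnitary {n : ℕ} {W : Type} (x : Fin n → Bool) (ψ : QBasis n W → ℂ) : QBasis n W → ℂ :=
  fun b => ψ (b.1, xor b.2.1 (x b.1), b.2.2)

/-- A step of a quantum query algorithm: a query, or a unitary independent of the input. -/
inductive QStep (n : ℕ) (W : Type) [Fintype W] [DecidableEq W] : Type
  | query : QStep n W
  | unitary (U : Matrix.unitaryGroup (QBasis n W) ℂ) : QStep n W

namespace QStep

variable {n : ℕ} {W : Type} [Fintype W] [DecidableEq W]

/-- The effect of a step on the state, for the input `x`. -/
noncomputable def apply (x : Fin n → Bool) : QStep n W → (QBasis n W → ℂ) → (QBasis n W → ℂ)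
  | query, ψ => queryUnitary x ψ
  | unitary U, ψ => (U : Matrix (QBasis n W) (QBasis n W) ℂ) *ᵥ ψ

/-- The number of queries of a step. -/
def cost : QStep n W → ℕ
  | query => 1
  | unitary _ => 0

end QStep

/-- A quantum query algorithm on inputs of length `n`: a finite sequence of queries and of
unitaries that do not depend on the input, started in a basis state; at the end all registers are
measured in the computational basis and the answer is read off from the measured basis state. -/
structure QueryAlg (n : ℕ) where
  /-- the work space -/
  W : Type
  [fintypeW : Fintype W]
  [decEqW : DecidableEq W]
  /-- the initial basis state -/
  start : QBasis n W
  /-- the steps, in the order of their execution -/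
  steps : List (QStep n W)
  /-- the answer, as a function of the measured basis state -/
  answer : QBasis n W → Bool

attribute [instance] QueryAlg.fintypeW QueryAlg.decEqW

namespace QueryAlg

variable {n : ℕ}

/-- The state before the measurement, on input `x`. -/
noncomputable def finalState (A : QueryAlg n) (x : Fin n → Bool) : QBasis n A.W → ℂ :=
  A.steps.foldl (fun ψ s => s.apply x ψ) (Pi.single A.start 1)

/-- The probability that the answer on input `x` is `c` (Born rule). -/
noncomputable def outputProb (A : QueryAlg n) (x : Fin n → Bool) (c : Bool) : ℝ :=
  ∑ b : QBasis n A.W, if A.answer b = c then ‖A.finalState x b‖ ^ 2 else 0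

/-- The number of queries. -/
def numQueries (A : QueryAlg n) : ℕ := (A.steps.map QStep.cost).sum

end QueryAlg

/-- A quantum query algorithm that first draws a uniformly random seed. -/
structure RandQueryAlg (n : ℕ) where
  /-- the seeds -/
  Seed : Type
  [fintypeSeed : Fintype Seed]
  [nonemptySeed : Nonempty Seed]
  /-- the algorithm that is run for a given seed -/
  alg : Seed → QueryAlg n

attribute [instance] RandQueryAlg.fintypeSeed RandQueryAlg.nonemptySeed

namespace RandQueryAlg

variable {n : ℕ}

/-- The probability, over the seed and the measurement, that the answer on input `x` is `c`. -/
noncomputable def outputProb (A : RandQueryAlg n) (x : Fin n → Bool) (c : Bool) : ℝ :=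
  (∑ s : A.Seed, (A.alg s).outputProb x c) / Fintype.card A.Seed

/-- The query complexity: the largest number of queries over all seeds. -/
noncomputable def queryComplexity (A : RandQueryAlg n) : ℕ :=
  Finset.univ.sup fun s : A.Seed => (A.alg s).numQueries

end RandQueryAlg

/-! ### Unitaries used by the algorithm -/

/-- The unitary `|b⟩ ↦ |σ b⟩` of a permutation `σ` of the basis. -/
def permUnitary {B : Type} [Fintype B] [DecidableEq B] (σ : Equiv.Perm B) :
    Matrix.unitaryGroup B ℂ :=
  ⟨Matrix.of fun b' b => if b' = σ b then 1 else 0, by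
    rw [Matrix.mem_unitaryGroup_iff']
    ext a b
    simp [Matrix.mul_apply, Matrix.star_apply, Matrix.one_apply, eq_comm]⟩

open Classical in
/-- The unitary `|b⟩ ↦ -|b⟩` if `b` is marked, and `|b⟩ ↦ |b⟩` otherwise. -/
noncomputable def phaseUnitary {B : Type} [Fintype B] [DecidableEq B] (marked : B → Prop) :
    Matrix.unitaryGroup B ℂ :=
  ⟨Matrix.diagonal fun b => if marked b then -1 else 1, by
    rw [Matrix.mem_unitaryGroup_iff', Matrix.star_eq_conjTranspose,
      Matrix.diagonal_conjTranspose, Matrix.diagonal_mul_diagonal, ← Matrix.diagonal_one]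
    congr 1
    funext b
    by_cases h : marked b <;> simp [h]⟩

/-- The quantum Fourier transform on `N` basis states; it maps `|0⟩` to the uniform
superposition. -/
noncomputable def fourierUnitary (N : ℕ) : Matrix.unitaryGroup (Fin N) ℂ :=
  ⟨Matrix.of fun a b => Complex.exp (2 * Real.pi * Complex.I * (a : ℕ) * (b : ℕ) / N) / √(N : ℝ),
   by
    rw [Matrix.mem_unitaryGroup_iff]
    ext a c
    have hN : (0 : ℝ) < N := by exact_mod_cast a.pos
    have hNC : (N : ℂ) ≠ 0 := by exact_mod_cast hN.ne'
    have hs : ((√(N : ℝ) : ℝ) : ℂ) * ((√(N : ℝ) : ℝ) : ℂ) = N := by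
      rw [← Complex.ofReal_mul, Real.mul_self_sqrt hN.le]; simp
    set ζ : ℂ := Complex.exp (2 * Real.pi * Complex.I * (((a : ℕ) : ℂ) - ((c : ℕ) : ℂ)) / N)
      with hζ
    have key : ∀ b : Fin N,
        Complex.exp (2 * Real.pi * Complex.I * (a : ℕ) * (b : ℕ) / N) / √(N : ℝ) *
          star (Complex.exp (2 * Real.pi * Complex.I * (c : ℕ) * (b : ℕ) / N) / √(N : ℝ))
        = ζ ^ (b : ℕ) / N := by
      intro b
      rw [Complex.star_def, map_div₀, Complex.conj_ofReal, ← Complex.exp_conj, div_mul_div_comm,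
        hs, ← Complex.exp_add, hζ, ← Complex.exp_nat_mul]
      congr 2
      simp only [map_div₀, map_mul, Complex.conj_I, Complex.conj_ofReal, map_natCast, map_ofNat]
      field_simp
      ring
    simp only [Matrix.mul_apply, Matrix.star_apply, Matrix.of_apply, key]
    rw [← Finset.sum_div, Fin.sum_univ_eq_sum_range (fun b => ζ ^ b) N]
    by_cases hac : a = c
    · subst hac
      simp [hζ, hNC]
    · have hζN : ζ ^ N = 1 := by
        rw [hζ, ← Complex.exp_nat_mul, Complex.exp_eq_one_iff]
        refine ⟨(a : ℤ) - (c : ℤ), ?_⟩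
        push_cast
        field_simp
      have hζ1 : ζ ≠ 1 := by
        intro h
        rw [hζ, Complex.exp_eq_one_iff] at h
        obtain ⟨k, hk⟩ := h
        have h2 : (((a : ℕ) : ℂ) - ((c : ℕ) : ℂ)) = k * N := by
          have := Complex.two_pi_I_ne_zero
          field_simp at hk
          linear_combination hk
        have h3 : ((a : ℕ) : ℤ) - ((c : ℕ) : ℤ) = k * N := by exact_mod_cast h2
        have ha := a.isLt
        have hc := c.isLt
        apply hac
        have hk0 : k = 0 := by
          by_contra hk0
          rcases lt_or_gt_of_ne hk0 with h | h
          · nlinarith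
          · nlinarith
        rw [hk0] at h3
        ext
        omega
      have := mul_neg_geom_sum ζ N
      rw [hζN, sub_self, mul_eq_zero, sub_eq_zero] at this
      rcases this with h | h
      · exact absurd h.symm hζ1
      · simp [h, hac]⟩

/-- Grover's diffusion `2 |s⟩⟨s| - 1`, where `|s⟩` is the uniform superposition of `N` basis
states. -/
noncomputable def diffusionUnitary (N : ℕ) : Matrix.unitaryGroup (Fin N) ℂ :=
  ⟨Matrix.of fun a b => 2 / (N : ℂ) - if a = b then 1 else 0, by
    rw [Matrix.mem_unitaryGroup_iff]
    ext a c
    have hN : (N : ℂ) ≠ 0 := by exact_mod_cast a.pos.ne'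
    have h : ∀ b : Fin N, (2 / (N : ℂ) - if a = b then 1 else 0) *
        star (2 / (N : ℂ) - if c = b then 1 else 0)
        = 4 / ((N : ℂ) * N) - (2 / N) * (if a = b then 1 else 0)
          - (2 / N) * (if c = b then 1 else 0)
          + (if a = b then (if c = b then 1 else 0) else 0) := by
      intro b
      split_ifs <;> simp <;> field_simp <;> ring
    simp only [Matrix.mul_apply, Matrix.star_apply, Matrix.of_apply, h]
    simp only [Finset.sum_add_distrib, Finset.sum_sub_distrib, ← Finset.mul_sum]
    simp [Matrix.one_apply, eq_comm]
    field_simp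
    ring⟩

open Classical in
/-- If the basis `B` is a product `A × R` (through `e`), the unitary `U ⊗ 1` that acts as `U` on the
factor `A` and as the identity on `R`. -/
noncomputable def onFactor {A B R : Type} [Fintype A] [DecidableEq A] [Fintype B] [DecidableEq B]
    [Fintype R] (e : B ≃ A × R) (U : Matrix.unitaryGroup A ℂ) : Matrix.unitaryGroup B ℂ :=
  ⟨Matrix.of fun b' b =>
      if (e b').2 = (e b).2 then (U : Matrix A A ℂ) (e b').1 (e b).1 else 0, by
    have h : (Matrix.of fun b' b =>
        if (e b').2 = (e b).2 then (U : Matrix A A ℂ) (e b').1 (e b).1 else 0)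
        = (Matrix.kroneckerMap (· * ·) (U : Matrix A A ℂ) (1 : Matrix R R ℂ)).submatrix e e := by
      ext b' b
      simp [Matrix.one_apply]
    have hU := Matrix.kronecker_mem_unitary U.2 (one_mem (Matrix.unitaryGroup R ℂ))
    rw [Unitary.mem_iff] at hU
    rw [h, Matrix.mem_unitaryGroup_iff', Matrix.star_eq_conjTranspose,
      Matrix.conjTranspose_submatrix, Matrix.submatrix_mul_equiv, ← Matrix.star_eq_conjTranspose,
      hU.1, Matrix.submatrix_one_equiv]⟩

/-! ### The algorithm -/

namespace MeetInTheMiddle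

/-- `L = ⌊n^{1/3}⌋`; the first index set is `{0, …, L - 1}`. -/
noncomputable def sizeI (n : ℕ) : ℕ := ⌊(n : ℝ) ^ (1 / 3 : ℝ)⌋₊

/-- The number of elements of the second index set `{α L : 0 ≤ α ≤ ⌊n / L⌋}`. -/
noncomputable def sizeJ (n : ℕ) : ℕ := n / sizeI n + 1

/-- The number `m = (2 / ε) log₂ n` of random offsets, rounded up. -/
noncomputable def numOffsets (n : ℕ) (ε : ℝ) : ℕ := ⌈2 / ε * Real.logb 2 n⌉₊

/-- The number of independent repetitions in the Grover search. -/
def reps : ℕ := 9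

/-- In each repetition the number of Grover iterations is uniform in `{0, …, maxIter n - 1}`. -/
noncomputable def maxIter (n : ℕ) : ℕ := ⌈√(sizeJ n : ℝ)⌉₊

/-- The work space: the stored strings `xⁱ` (the content of the trie), and for each repetition of
the Grover search a register holding `α` (the current element of the search space is `j = α L`) and
a register for the string `x̃ʲ`. -/
@[ext]
structure Work (n m : ℕ) where
  /-- the strings stored in the trie -/
  stored : Fin (sizeI n) → Fin m → Bool
  /-- the registers holding `α` -/
  index : Fin reps → Fin (sizeJ n)
  /-- the registers for the strings `x̃ʲ` -/
  sample : Fin reps → Fin m → Bool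

/-- The work space as a product of its registers. -/
def workEquiv (n m : ℕ) : Work n m ≃
    (Fin (sizeI n) → Fin m → Bool) × (Fin reps → Fin (sizeJ n)) × (Fin reps → Fin m → Bool) where
  toFun w := (w.stored, w.index, w.sample)
  invFun t := ⟨t.1, t.2.1, t.2.2⟩
  left_inv _ := rfl
  right_inv _ := rfl

noncomputable instance (n m : ℕ) : DecidableEq (Work n m) := (workEquiv n m).decidableEq

noncomputable instance (n m : ℕ) : Fintype (Work n m) := Fintype.ofEquiv _ (workEquiv n m).symm

variable {n m : ℕ}

/-- The element `j = α L` of the search space held in repetition `s`. -/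
noncomputable def current (s : Fin reps) (w : Work n m) : ℕ := (w.index s : ℕ) * sizeI n

/-- `i + j = 2|u| - 1` for some lengths `|u|, |v| ≥ 1` with `2|u| + 2|v| = n`. -/
def Symmetric (n i j : ℕ) : Prop :=
  ∃ k l : ℕ, 1 ≤ k ∧ 1 ≤ l ∧ 2 * k + 2 * l = n ∧ i + j + 1 = 2 * k

/-- The search predicate: the string held in repetition `s` is stored in the trie, as the string of
some `i` with `i + j = 2|u| - 1` for possible lengths `|u|`, `|v|`. -/
def Hit (s : Fin reps) (w : Work n m) : Prop :=
  ∃ i : Fin (sizeI n), Symmetric n i (current s w) ∧ w.stored i = w.sample s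

/-- Flip bit `k` of the stored string number `i`. -/
noncomputable def flipStored (i : Fin (sizeI n)) (k : Fin m) : Equiv.Perm (Work n m) :=
  Function.Involutive.toPerm
    (fun w => { w with
      stored := fun i' k' => xor (w.stored i' k') (decide (i' = i ∧ k' = k)) })
    (fun w => by ext <;> simp)

/-- Flip bit `k` of the string held in repetition `s`. -/
noncomputable def flipSample (s : Fin reps) (k : Fin m) : Equiv.Perm (Work n m) :=
  Function.Involutive.toPerm
    (fun w => { w with
      sample := fun s' k' => xor (w.sample s' k') (decide (s' = s ∧ k' = k)) })
    (fun w => by ext <;> simp)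

/-- `|i⟩|z⟩|w⟩ ↦ |i + a(w) mod n⟩|z⟩|w⟩`. -/
noncomputable def addAddress [NeZero n] (a : Work n m → Fin n) : Equiv.Perm (QBasis n (Work n m)) where
  toFun b := (b.1 + a b.2.2, b.2)
  invFun b := (b.1 - a b.2.2, b.2)
  left_inv b := by simp
  right_inv b := by simp

/-- `|i⟩|z⟩|w⟩ ↦ |i⟩|z⟩|τ w⟩` if `z = 1`; the identity if `z = 0`. -/
noncomputable def controlled (τ : Equiv.Perm (Work n m)) : Equiv.Perm (QBasis n (Work n m)) where
  toFun b := (b.1, b.2.1, if b.2.1 then τ b.2.2 else b.2.2)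
  invFun b := (b.1, b.2.1, if b.2.1 then τ.symm b.2.2 else b.2.2)
  left_inv b := by rcases b with ⟨i, z, w⟩; cases z <;> simp
  right_inv b := by rcases b with ⟨i, z, w⟩; cases z <;> simp

/-- Read the input bit at the address `a(w)` and apply `τ` to the work space if it is `1`; the
index and output registers are used in state `|0⟩|0⟩` and restored to it by a second query. -/
noncomputable def readBit [NeZero n] (a : Work n m → Fin n) (τ : Equiv.Perm (Work n m)) : List (QStep n (Work n m)) :=
  [.unitary (permUnitary (addAddress a)), .query, .unitary (permUnitary (controlled τ)), .query,
    .unitary (permUnitary (addAddress a).symm)]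

/-- Store `xⁱ = (x_{(i - p₁) mod n}, …, x_{(i - p_m) mod n})` for all `i` of the first index
set. -/
noncomputable def storeStrings [NeZero n] (p : Fin m → Fin n) : List (QStep n (Work n m)) :=
  (List.finRange (sizeI n)).flatMap fun i : Fin (sizeI n) => (List.finRange m).flatMap fun k =>
    readBit (fun _ => Fin.ofNat n (i : ℕ) - p k) (flipStored i k)

/-- Add (bitwise, mod 2) the string `x̃ʲ = (x_{(j + p₁) mod n}, …, x_{(j + p_m) mod n})` to the
string register of repetition `s`, where `j` is the element held in repetition `s`. Applied to
`|0⟩` this computes `x̃ʲ`; applied a second time it restores `|0⟩`. -/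
noncomputable def addSample [NeZero n] (p : Fin m → Fin n) (s : Fin reps) : List (QStep n (Work n m)) :=
  (List.finRange m).flatMap fun k =>
    readBit (fun w => Fin.ofNat n (current s w) + p k) (flipSample s k)

/-- Separate the `α`-register of repetition `s` from all other registers. -/
noncomputable def splitRegister (s : Fin reps) :
    QBasis n (Work n m) ≃ Fin (sizeJ n) ×
      (Fin n × Bool × (Fin (sizeI n) → Fin m → Bool) ×
        ({s' : Fin reps // s' ≠ s} → Fin (sizeJ n)) × (Fin reps → Fin m → Bool)) where
  toFun b := (b.2.2.index s, b.1, b.2.1, b.2.2.stored, fun s' => b.2.2.index s', b.2.2.sample)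
  invFun c := (c.2.1, c.2.2.1,
    { stored := c.2.2.2.1
      index := fun s' => if h : s' = s then c.1 else c.2.2.2.2.1 ⟨s', h⟩
      sample := c.2.2.2.2.2 })
  left_inv b := by
    rcases b with ⟨i, z, t, r, y⟩
    simp only [Prod.mk.injEq, Work.mk.injEq, true_and, and_true]
    funext s'
    by_cases h : s' = s
    · simp [h]
    · simp [h]
  right_inv c := by
    rcases c with ⟨a, i, z, t, r, y⟩
    simp only [Prod.mk.injEq, true_and, and_true, dite_true]
    funext s'
    simp [s'.2]

/-- The unitary that acts as `U` on the `α`-register of repetition `s` and as the identity on all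
other registers. -/
noncomputable def onRegister (s : Fin reps) (U : Matrix.unitaryGroup (Fin (sizeJ n)) ℂ) :
    Matrix.unitaryGroup (QBasis n (Work n m)) ℂ :=
  onFactor (splitRegister s) U

/-- One Grover iteration in repetition `s`: a sign flip of the `j` that satisfy the search
predicate, followed by the diffusion. -/
noncomputable def groverIteration [NeZero n] (p : Fin m → Fin n) (s : Fin reps) :
    List (QStep n (Work n m)) :=
  addSample p s ++ [.unitary (phaseUnitary fun b => Hit s b.2.2)] ++ addSample p s ++
    [.unitary (onRegister s (diffusionUnitary (sizeJ n)))]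

/-- Repetition `s` with `r` Grover iterations: the uniform superposition over the search space, the
iterations, and the computation of `x̃ʲ` for the resulting `j`. -/
noncomputable def groverRun [NeZero n] (p : Fin m → Fin n) (s : Fin reps) (r : ℕ) :
    List (QStep n (Work n m)) :=
  [.unitary (onRegister s (fourierUnitary (sizeJ n)))] ++
    (List.replicate r (groverIteration p s)).flatten ++ addSample p s

open Classical in
/-- The algorithm for fixed offsets `p` and fixed numbers `r s` of Grover iterations: store the
strings `xⁱ`, run the Grover search, measure, and answer `true` iff one of the repetitions has
found an element that satisfies the search predicate. -/
noncomputable def fixedSeedAlg [NeZero n] (p : Fin m → Fin n) (r : Fin reps → Fin (maxIter n)) :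
    QueryAlg n where
  W := Work n m
  start := (0, false,
    { stored := fun _ _ => false
      index := fun _ => ⟨0, Nat.succ_pos _⟩
      sample := fun _ _ => false })
  steps := storeStrings p ++ (List.finRange reps).flatMap fun s => groverRun p s (r s)
  answer b := decide (∃ s, Hit s b.2.2)

theorem maxIter_pos (n : ℕ) : 0 < maxIter n :=
  Nat.ceil_pos.2 (Real.sqrt_pos.2 (by exact_mod_cast Nat.succ_pos _))

end MeetInTheMiddle

open MeetInTheMiddle in
/-- The meet-in-the-middle algorithm: the seed consists of `m` offsets, uniform and independent in
`{0, …, n - 1}`, and of the numbers of Grover iterations of the repetitions. -/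
noncomputable def meetInTheMiddle (n : ℕ) [NeZero n] (ε : ℝ) : RandQueryAlg n where
  Seed := (Fin (numOffsets n ε) → Fin n) × (Fin reps → Fin (maxIter n))
  nonemptySeed := ⟨(fun _ => 0, fun _ => ⟨0, maxIter_pos n⟩)⟩
  alg σ := fixedSeedAlg σ.1 σ.2

/-! A word `u uʳ v vʳ` with `|u| = k` is a word invariant under the reflection `a ↦ 2k - 1 - a` of
`ℤ / n`. If `i + j = 2k - 1`, this reflection swaps the positions `i - p` and `j + p` for every
offset `p`, so comparing `xⁱ` with `x̃ʲ` tests the symmetry at random places.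

For `x` in the language, dividing `2k - 1` by `L` yields a pair `(i, j)` that matches for all
offsets (`exists_marked_of_mem_LRev`). For `x` far from it, every such reflection fails on at least
`ε n` positions, because symmetrising `x` gives a word of the language
(`RevPromise.le_card_reflection_ne`). A pair then matches with probability at most `(1 - ε)^m`, and
a union bound over at most `2n` pairs leaves at most `1/4` (`card_exists_marked_le`).

On the quantum side, the final state is a product over the repetitions (`finalState_fixedSeedAlg`),
so their failure probabilities multiply. With `t = N sin² θ` marked elements, `r` iterations miss
with probability `cos² ((2r + 1) θ)`; its mean over `r < M` is at most `3/4` once `M ≥ √N`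
(`sum_groverAmplitude_not_marked_le`), and `(3/4)^9 ≤ 1/4`. Without marked elements the answer is
never `true`. -/

/-! ### Evolution of states and action of the elementary unitaries. -/

namespace QStep

variable {n : ℕ} {W : Type} [Fintype W] [DecidableEq W]

/-- The effect of a sequence of steps on the state, for the input `x`. -/
noncomputable def run (x : Fin n → Bool) (l : List (QStep n W)) (ψ : QBasis n W → ℂ) :
    QBasis n W → ℂ :=
  l.foldl (fun ψ s => s.apply x ψ) ψ

@[simp] theorem run_nil (x : Fin n → Bool) (ψ : QBasis n W → ℂ) : run x [] ψ = ψ := rfl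

@[simp] theorem run_cons (x : Fin n → Bool) (s : QStep n W) (l : List (QStep n W))
    (ψ : QBasis n W → ℂ) : run x (s :: l) ψ = run x l (s.apply x ψ) := rfl

theorem run_append (x : Fin n → Bool) (l l' : List (QStep n W)) (ψ : QBasis n W → ℂ) :
    run x (l ++ l') ψ = run x l' (run x l ψ) := List.foldl_append

theorem sum_norm_sq_apply (x : Fin n → Bool) (s : QStep n W) (ψ : QBasis n W → ℂ) :
    ∑ b, ‖s.apply x ψ b‖ ^ 2 = ∑ b, ‖ψ b‖ ^ 2 := by
  cases s with
  | query =>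
    have hinv : Function.Involutive
        (fun b : QBasis n W => ((b.1, xor b.2.1 (x b.1), b.2.2) : QBasis n W)) := by
      rintro ⟨i, z, w⟩
      simp
    exact Equiv.sum_comp hinv.toPerm fun b => ‖ψ b‖ ^ 2
  | unitary U =>
    have key : ∀ φ : QBasis n W → ℂ, ((∑ b, ‖φ b‖ ^ 2 : ℝ) : ℂ) = star φ ⬝ᵥ φ := by
      intro φ
      simp [dotProduct, Complex.conj_mul']
    have hU : (U : Matrix (QBasis n W) (QBasis n W) ℂ)ᴴ * U = 1 :=
      Matrix.mem_unitaryGroup_iff'.1 U.2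
    apply Complex.ofReal_injective
    rw [key, key]
    simp only [apply]
    rw [Matrix.star_mulVec, Matrix.dotProduct_mulVec, Matrix.vecMul_vecMul, hU, Matrix.vecMul_one]

theorem sum_norm_sq_run (x : Fin n → Bool) (l : List (QStep n W)) (ψ : QBasis n W → ℂ) :
    ∑ b, ‖run x l ψ b‖ ^ 2 = ∑ b, ‖ψ b‖ ^ 2 := by
  induction l generalizing ψ with
  | nil => rfl
  | cons s l ih => rw [run_cons, ih, sum_norm_sq_apply]

end QStep

theorem QueryAlg.finalState_eq_run {n : ℕ} (A : QueryAlg n) (x : Fin n → Bool) :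
    A.finalState x = QStep.run x A.steps (Pi.single A.start 1) := rfl

/-- Serves as the trivial error bound for offsets that create a false match. -/
theorem QueryAlg.outputProb_le_one {n : ℕ} (A : QueryAlg n) (x : Fin n → Bool) (c : Bool) :
    A.outputProb x c ≤ 1 := by
  calc A.outputProb x c ≤ ∑ b, ‖A.finalState x b‖ ^ 2 :=
        Finset.sum_le_sum fun b _ => by split_ifs <;> [exact le_rfl; positivity]
    _ = ∑ b, ‖(Pi.single A.start 1 : QBasis n A.W → ℂ) b‖ ^ 2 := by
        rw [A.finalState_eq_run, QStep.sum_norm_sq_run]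
    _ = 1 := by
        rw [Finset.sum_eq_single A.start] <;> simp +contextual

theorem permUnitary_mulVec {B : Type} [Fintype B] [DecidableEq B] (σ : Equiv.Perm B) (ψ : B → ℂ) :
    (permUnitary σ : Matrix B B ℂ) *ᵥ ψ = fun b => ψ (σ.symm b) := by
  ext b
  have h : ∀ b', (b = σ b') = (b' = σ.symm b) := fun b' => by
    rw [Equiv.eq_symm_apply, eq_comm (a := b)]
  simp [permUnitary, Matrix.mulVec, dotProduct, h]

open Classical in
theorem phaseUnitary_mulVec {B : Type} [Fintype B] [DecidableEq B] (marked : B → Prop)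
    (ψ : B → ℂ) :
    (phaseUnitary marked : Matrix B B ℂ) *ᵥ ψ = fun b => if marked b then -ψ b else ψ b := by
  ext b
  simp only [phaseUnitary, Matrix.mulVec_diagonal]
  split_ifs <;> simp

theorem onFactor_mulVec {A B R : Type} [Fintype A] [DecidableEq A] [Fintype B] [DecidableEq B]
    [Fintype R] (e : B ≃ A × R) (U : Matrix.unitaryGroup A ℂ) (ψ : B → ℂ) (b : B) :
    ((onFactor e U : Matrix B B ℂ) *ᵥ ψ) b
      = ∑ a, (U : Matrix A A ℂ) (e b).1 a * ψ (e.symm (a, (e b).2)) := by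
  classical
  simp only [onFactor, Matrix.mulVec, dotProduct, Matrix.of_apply]
  rw [← Equiv.sum_comp e.symm, Fintype.sum_prod_type]
  simp

theorem diffusionUnitary_mulVec {N : ℕ} (ψ : Fin N → ℂ) (a : Fin N) :
    ((diffusionUnitary N : Matrix (Fin N) (Fin N) ℂ) *ᵥ ψ) a = 2 / N * ∑ b, ψ b - ψ a := by
  simp [diffusionUnitary, Matrix.mulVec, dotProduct, sub_mul, Finset.mul_sum]

theorem fourierUnitary_mulVec_single {N : ℕ} (z : Fin N) (hz : (z : ℕ) = 0) :
    (fourierUnitary N : Matrix (Fin N) (Fin N) ℂ) *ᵥ Pi.single z 1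
      = fun _ => 1 / ((√(N : ℝ) : ℝ) : ℂ) := by
  ext a
  simp [fourierUnitary, hz]

/-! ### Exact simulation of the algorithm on product states. -/

namespace MeetInTheMiddle

variable {n m : ℕ}

/-- The state `|0⟩|0⟩ ⊗ φ`. -/
def embed [NeZero n] (φ : Work n m → ℂ) : QBasis n (Work n m) → ℂ :=
  fun b => if b.1 = 0 ∧ b.2.1 = false then φ b.2.2 else 0

/-- As `τ` preserves the address, the second query reads the same bit as the first and clears the
output register, after which the address can be subtracted. Amplitudes are pulled back along
inverses; `hτ` lets `τ` itself appear on the right. -/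
theorem run_readBit_embed [NeZero n] (x : Fin n → Bool) (a : Work n m → Fin n)
    (τ : Equiv.Perm (Work n m)) (hτ : τ.symm = τ) (ha : ∀ w, a (τ w) = a w)
    (φ : Work n m → ℂ) :
    QStep.run x (readBit a τ) (embed φ) = embed fun w => φ (if x (a w) then τ w else w) := by
  funext b
  obtain ⟨i, z, w⟩ := b
  simp only [readBit, QStep.run_cons, QStep.run_nil, QStep.apply, permUnitary_mulVec, queryUnitary,
    Equiv.symm_symm, embed]
  simp only [addAddress, controlled, Equiv.coe_fn_mk, Equiv.coe_fn_symm_mk, hτ]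
  by_cases hi : i = 0
  · subst hi
    cases z <;> cases hx : x (a w) <;> simp [hx, ha]
  -- Equal addresses are added and subtracted, so a nonzero index never becomes zero.
  · have h : ∀ w', a w' = a w → i + a w - a w' ≠ 0 := by
      intro w' h
      simpa [h] using hi
    rw [if_neg, if_neg]
    · simp [hi]
    · rintro ⟨h', -⟩
      refine h _ ?_ h'
      split_ifs
      · exact ha w
      · rfl

theorem flipStored_symm (i : Fin (sizeI n)) (k : Fin m) :
    (flipStored i k : Equiv.Perm (Work n m)).symm = flipStored i k := rfl

theorem flipSample_symm (s : Fin reps) (k : Fin m) :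
    (flipSample s k : Equiv.Perm (Work n m)).symm = flipSample s k := rfl

/-- Add a mask to the stored strings. -/
def maskStored (M : Fin (sizeI n) → Fin m → Bool) (w : Work n m) : Work n m :=
  { w with stored := fun i k => xor (w.stored i k) (M i k) }

/-- Conditional bit flips add up to one XOR mask. `Nodup` is needed because a bit read twice would
cancel. -/
theorem run_storeString [NeZero n] (x : Fin n → Bool) (p : Fin m → Fin n) (i : Fin (sizeI n))
    (l : List (Fin m)) (hl : l.Nodup) (φ : Work n m → ℂ) :
    QStep.run x (l.flatMap fun k =>
        readBit (fun _ => Fin.ofNat n (i : ℕ) - p k) (flipStored i k)) (embed φ)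
      = embed fun w => φ (maskStored (fun i' k =>
          decide (i' = i ∧ k ∈ l) && x (Fin.ofNat n (i : ℕ) - p k)) w) := by
  induction l generalizing φ with
  | nil => simp [maskStored]
  | cons k l ih =>
    rw [List.nodup_cons] at hl
    rw [List.flatMap_cons, QStep.run_append,
      run_readBit_embed _ _ _ (flipStored_symm i k) (fun _ => rfl), ih hl.2]
    congr 1
    funext w
    congr 1
    ext i' k' : 3
    · by_cases hi : i' = i <;> by_cases hk : k' = k
      · subst hi hk
        cases hx : x (Fin.ofNat n (i' : ℕ) - p k') <;> simp [maskStored, flipStored, hx, hl.1, -Fin.ofNat_eq_cast]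
      all_goals
        cases hx : x (Fin.ofNat n (i : ℕ) - p k) <;> simp [maskStored, flipStored, hi, hk]
    all_goals split_ifs <;> rfl

/-- The strings `xⁱ`. -/
def trie [NeZero n] (x : Fin n → Bool) (p : Fin m → Fin n) : Fin (sizeI n) → Fin m → Bool :=
  fun i k => x (Fin.ofNat n (i : ℕ) - p k)

theorem run_storeStrings [NeZero n] (x : Fin n → Bool) (p : Fin m → Fin n) (φ : Work n m → ℂ) :
    QStep.run x (storeStrings p) (embed φ) = embed fun w => φ (maskStored (trie x p) w) := by
  have key : ∀ (l : List (Fin (sizeI n))), l.Nodup → ∀ φ : Work n m → ℂ,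
      QStep.run x (l.flatMap fun i : Fin (sizeI n) => (List.finRange m).flatMap fun k =>
        readBit (fun _ => Fin.ofNat n (i : ℕ) - p k) (flipStored i k)) (embed φ)
      = embed fun w => φ (maskStored (fun i k => decide (i ∈ l) && trie x p i k) w) := by
    intro l
    induction l with
    | nil => intro _ φ; simp [maskStored]
    | cons i l ih =>
      intro hl φ
      rw [List.nodup_cons] at hl
      rw [List.flatMap_cons, QStep.run_append, run_storeString _ _ _ _ (List.nodup_finRange m),
        ih hl.2]
      congr 1
      funext w
      congr 1
      ext i' k' : 3
      · by_cases hi : i' = i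
        · subst hi
          simp [maskStored, trie, hl.1]
        · simp [maskStored, trie, hi]
      all_goals rfl
  simpa [storeStrings, -Fin.ofNat_eq_cast] using key _ (List.nodup_finRange _) φ

/-- The string `x̃ʲ` for `j = α L`. -/
noncomputable def probe [NeZero n] (x : Fin n → Bool) (p : Fin m → Fin n) (α : Fin (sizeJ n)) :
    Fin m → Bool :=
  fun k => x (Fin.ofNat n ((α : ℕ) * sizeI n) + p k)

/-- Add to the string register of repetition `s` a mask that depends on its `α`-register. -/
def maskSample (s : Fin reps) (M : Fin (sizeJ n) → Fin m → Bool) (w : Work n m) : Work n m :=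
  { w with sample := fun s' k => xor (w.sample s' k) (decide (s' = s) && M (w.index s) k) }

theorem run_addSample [NeZero n] (x : Fin n → Bool) (p : Fin m → Fin n) (s : Fin reps)
    (φ : Work n m → ℂ) :
    QStep.run x (addSample p s) (embed φ) = embed fun w => φ (maskSample s (probe x p) w) := by
  have key : ∀ (l : List (Fin m)), l.Nodup → ∀ φ : Work n m → ℂ,
      QStep.run x (l.flatMap fun k =>
        readBit (fun w => Fin.ofNat n (current s w) + p k) (flipSample s k)) (embed φ)
      = embed fun w => φ (maskSample s (fun α k => decide (k ∈ l) && probe x p α k) w) := by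
    intro l
    induction l with
    | nil => intro _ φ; simp [maskSample]
    | cons k l ih =>
      intro hl φ
      rw [List.nodup_cons] at hl
      rw [List.flatMap_cons, QStep.run_append,
        run_readBit_embed _ _ _ (flipSample_symm s k) (fun _ => rfl), ih hl.2]
      congr 1
      funext w
      congr 1
      have hcur : current s (maskSample s (fun α k => decide (k ∈ l) && probe x p α k) w)
        = (w.index s : ℕ) * sizeI n := rfl
      rw [hcur]
      ext s' k' : 3
      · split_ifs <;> rfl
      · split_ifs <;> rfl
      · by_cases hs : s' = s <;> by_cases hk : k' = k
        · subst hs hk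
          cases hx : x (Fin.ofNat n ((w.index s' : ℕ) * sizeI n) + p k') <;>
            simp [maskSample, flipSample, probe, hx, hl.1, -Fin.ofNat_eq_cast]
        all_goals
          cases hx : x (Fin.ofNat n ((w.index s : ℕ) * sizeI n) + p k) <;>
            simp [maskSample, flipSample, hs, hk]
  simpa [addSample, -Fin.ofNat_eq_cast] using key _ (List.nodup_finRange _) φ

/-- The state of the work space in which the stored strings are `X`, and the registers of
repetition `s` are in the state `∑ α, c s α |α⟩|y s α⟩`. -/
noncomputable def productState (X : Fin (sizeI n) → Fin m → Bool)
    (y : Fin reps → Fin (sizeJ n) → Fin m → Bool) (c : Fin reps → Fin (sizeJ n) → ℂ) :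
    Work n m → ℂ :=
  open Classical in
  fun w => if w.stored = X ∧ ∀ s, w.sample s = y s (w.index s) then ∏ s, c s (w.index s) else 0

theorem productState_maskSample (X : Fin (sizeI n) → Fin m → Bool)
    (y : Fin reps → Fin (sizeJ n) → Fin m → Bool) (c : Fin reps → Fin (sizeJ n) → ℂ)
    (s : Fin reps) (M : Fin (sizeJ n) → Fin m → Bool) :
    (fun w : Work n m => productState X y c (maskSample s M w))
      = productState X (Function.update y s fun α k => xor (y s α k) (M α k)) c := by
  funext w
  simp only [productState, maskSample]
  congr 1
  simp only [eq_iff_iff, and_congr_right_iff]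
  intro _
  refine forall_congr' fun s' => ?_
  by_cases hs : s' = s
  · subst hs
    simp only [decide_true, Bool.true_and, Function.update_self, funext_iff]
    refine forall_congr' fun k => ?_
    cases w.sample s' k <;> cases y s' (w.index s') k <;> cases M (w.index s') k <;> simp
  · simp [hs]

/-- By `hy` the string register of repetition `s` does not depend on `α`. Otherwise the two would be
entangled and `U` would destroy the product form; this is why an iteration uncomputes `x̃ʲ` before
the diffusion. -/
theorem onRegister_mulVec_productState [NeZero n] (X : Fin (sizeI n) → Fin m → Bool)
    (y : Fin reps → Fin (sizeJ n) → Fin m → Bool) (c : Fin reps → Fin (sizeJ n) → ℂ)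
    (s : Fin reps) (hy : ∀ α β, y s α = y s β) (U : Matrix.unitaryGroup (Fin (sizeJ n)) ℂ) :
    (onRegister (m := m) s U).1 *ᵥ
        embed (productState X y c)
      = embed (productState X y (Function.update c s
          ((U : Matrix (Fin (sizeJ n)) (Fin (sizeJ n)) ℂ) *ᵥ c s))) := by
  classical
  funext b
  obtain ⟨i, z, w⟩ := b
  rw [onRegister, onFactor_mulVec]
  simp only [splitRegister, Equiv.coe_fn_mk, Equiv.coe_fn_symm_mk, embed]
  by_cases hb : i = 0 ∧ z = false
  swap
  · simp [hb]
  simp only [hb, and_self, if_true]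
  have hidx : ∀ (a : Fin (sizeJ n)) (s' : Fin reps),
      (if _ : s' = s then a else w.index s') = Function.update w.index s a s' := by
    intro a s'
    by_cases h : s' = s
    · subst h; simp
    · simp [h]
  simp only [productState, hidx]
  have hcond : ∀ a : Fin (sizeJ n),
      (∀ s', w.sample s' = y s' (Function.update w.index s a s'))
        ↔ ∀ s', w.sample s' = y s' (w.index s') := by
    intro a
    refine forall_congr' fun s' => ?_
    by_cases h : s' = s
    · subst h
      rw [hy (Function.update w.index s' a s') (w.index s')]
    · rw [Function.update_of_ne h]
  simp only [hcond]
  by_cases hw : w.stored = X ∧ ∀ s', w.sample s' = y s' (w.index s')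
  swap
  · simp [hw]
  simp only [if_pos hw]
  -- Only factor `s` of the product of amplitudes is affected by `U`.
  rw [← Finset.mul_prod_erase Finset.univ _ (Finset.mem_univ s)]
  simp only [Function.update_self, Matrix.mulVec, dotProduct, Finset.sum_mul]
  refine Finset.sum_congr rfl fun a _ => ?_
  rw [← Finset.mul_prod_erase Finset.univ _ (Finset.mem_univ s), Function.update_self, ← mul_assoc]
  congr 1
  refine Finset.prod_congr rfl fun s' hs' => ?_
  have hne : s' ≠ s := (Finset.mem_erase.1 hs').1
  rw [Function.update_of_ne hne, Function.update_of_ne hne]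

/-- The elements `α` of the search space that satisfy the search predicate. -/
def Marked [NeZero n] (x : Fin n → Bool) (p : Fin m → Fin n) (α : Fin (sizeJ n)) : Prop :=
  ∃ i : Fin (sizeI n), Symmetric n i ((α : ℕ) * sizeI n) ∧ trie x p i = probe x p α

open Classical in
/-- A Grover iteration on the amplitudes of the search space. -/
noncomputable def groverStep {N : ℕ} (marked : Fin N → Prop) (c : Fin N → ℂ) : Fin N → ℂ :=
  (diffusionUnitary N).1 *ᵥ fun α => if marked α then -c α else c α

/-- The amplitudes after `r` Grover iterations from the uniform superposition. -/
noncomputable def groverAmplitude {N : ℕ} (marked : Fin N → Prop) (r : ℕ) : Fin N → ℂ :=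
  (groverStep marked)^[r] fun _ => 1 / ((√(N : ℝ) : ℝ) : ℂ)

-- On the support of the state the held string is determined by `α`, so the predicate depends on `α`
-- alone and the sign is absorbed into the amplitudes of repetition `s`.
open Classical in
theorem phaseUnitary_hit_mulVec_productState [NeZero n] (x : Fin n → Bool) (p : Fin m → Fin n)
    (y : Fin reps → Fin (sizeJ n) → Fin m → Bool) (c : Fin reps → Fin (sizeJ n) → ℂ)
    (s : Fin reps) (hy : y s = probe x p) :
    (phaseUnitary fun b : QBasis n (Work n m) => Hit s b.2.2).1 *ᵥ
        embed (productState (trie x p) y c)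
      = embed (productState (trie x p) y (Function.update c s fun α =>
          if Marked x p α then -c s α else c s α)) := by
  rw [phaseUnitary_mulVec]
  funext b
  obtain ⟨i, z, w⟩ := b
  simp only [embed, productState]
  by_cases hb : i = 0 ∧ z = false
  swap
  · simp [hb]
  simp only [hb, and_self, if_true]
  by_cases hw : w.stored = trie x p ∧ ∀ s', w.sample s' = y s' (w.index s')
  swap
  · simp [hw]
  have hit : Hit s w ↔ Marked x p (w.index s) := by
    simp only [Hit, Marked, current, hw.1, hw.2 s, hy]
  simp only [if_pos hw, hit]
  rw [← Finset.mul_prod_erase Finset.univ _ (Finset.mem_univ s),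
    ← Finset.mul_prod_erase Finset.univ _ (Finset.mem_univ s), Function.update_self]
  have hprod : ∏ s' ∈ Finset.univ.erase s, Function.update c s
        (fun α => if Marked x p α then -c s α else c s α) s' (w.index s')
      = ∏ s' ∈ Finset.univ.erase s, c s' (w.index s') :=
    Finset.prod_congr rfl fun s' hs' => by
      rw [Function.update_of_ne (Finset.mem_erase.1 hs').1]
  rw [hprod]
  split_ifs <;> ring

theorem run_addSample_productState [NeZero n] (x : Fin n → Bool) (p : Fin m → Fin n)
    (s : Fin reps) (X : Fin (sizeI n) → Fin m → Bool)
    (y : Fin reps → Fin (sizeJ n) → Fin m → Bool) (c : Fin reps → Fin (sizeJ n) → ℂ) :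
    QStep.run x (addSample p s) (embed (productState X y c))
      = embed (productState X
          (Function.update y s fun α k => xor (y s α k) (probe x p α k)) c) := by
  rw [run_addSample, productState_maskSample]

/-- The second `addSample` cancels the first, since the phase flip leaves the strings unchanged; the
diffusion then meets a cleared string register. -/
theorem run_groverIteration [NeZero n] (x : Fin n → Bool) (p : Fin m → Fin n) (s : Fin reps)
    (y : Fin reps → Fin (sizeJ n) → Fin m → Bool) (c : Fin reps → Fin (sizeJ n) → ℂ)
    (hy : y s = fun _ _ => false) :
    QStep.run x (groverIteration p s) (embed (productState (trie x p) y c))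
      = embed (productState (trie x p) y
          (Function.update c s (groverStep (Marked x p) (c s)))) := by
  simp only [groverIteration, QStep.run_append, QStep.run_cons, QStep.run_nil, QStep.apply]
  rw [run_addSample_productState, phaseUnitary_hit_mulVec_productState x p _ _ s (by simp [hy]),
    run_addSample_productState, onRegister_mulVec_productState]
  · simp only [Function.update_self, Function.update_idem, hy, Bool.false_xor, Bool.xor_self]
    rw [← hy, Function.update_eq_self]
    rfl
  · intro α β
    simp [hy]

theorem run_groverIterations [NeZero n] (x : Fin n → Bool) (p : Fin m → Fin n) (s : Fin reps)
    (y : Fin reps → Fin (sizeJ n) → Fin m → Bool) (c : Fin reps → Fin (sizeJ n) → ℂ)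
    (hy : y s = fun _ _ => false) (r : ℕ) :
    QStep.run x (List.replicate r (groverIteration p s)).flatten
        (embed (productState (trie x p) y c))
      = embed (productState (trie x p) y
          (Function.update c s ((groverStep (Marked x p))^[r] (c s)))) := by
  induction r generalizing c with
  | zero => simp
  | succ r ih =>
    rw [List.replicate_succ, List.flatten_cons, QStep.run_append, run_groverIteration _ _ _ _ _ hy,
      ih]
    simp

theorem run_groverRun [NeZero n] (x : Fin n → Bool) (p : Fin m → Fin n) (s : Fin reps) (r : ℕ)
    (y : Fin reps → Fin (sizeJ n) → Fin m → Bool) (c : Fin reps → Fin (sizeJ n) → ℂ)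
    (hy : y s = fun _ _ => false) (hc : c s = Pi.single ⟨0, Nat.succ_pos _⟩ 1) :
    QStep.run x (groverRun p s r) (embed (productState (trie x p) y c))
      = embed (productState (trie x p) (Function.update y s (probe x p))
          (Function.update c s (groverAmplitude (Marked x p) r))) := by
  simp only [groverRun, QStep.run_append, QStep.run_cons, QStep.run_nil, QStep.apply]
  rw [onRegister_mulVec_productState _ _ _ _ (by simp [hy]), run_groverIterations _ _ _ _ _ hy,
    run_addSample_productState, hc, fourierUnitary_mulVec_single _ rfl]
  simp [hy, groverAmplitude]

/-- Each repetition works on its own registers, and `Nodup` guarantees that it finds them in their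
initial state. -/
theorem run_groverRuns [NeZero n] (x : Fin n → Bool) (p : Fin m → Fin n) (r : Fin reps → ℕ)
    (l : List (Fin reps)) (hl : l.Nodup)
    (y : Fin reps → Fin (sizeJ n) → Fin m → Bool) (c : Fin reps → Fin (sizeJ n) → ℂ)
    (hy : ∀ s ∈ l, y s = fun _ _ => false)
    (hc : ∀ s ∈ l, c s = Pi.single ⟨0, Nat.succ_pos _⟩ 1) :
    QStep.run x (l.flatMap fun s => groverRun p s (r s)) (embed (productState (trie x p) y c))
      = embed (productState (trie x p) (fun s => if s ∈ l then probe x p else y s)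
          (fun s => if s ∈ l then groverAmplitude (Marked x p) (r s) else c s)) := by
  induction l generalizing y c with
  | nil => simp
  | cons s l ih =>
    rw [List.nodup_cons] at hl
    have hne : ∀ s' ∈ l, s' ≠ s := fun s' hs' h => hl.1 (h ▸ hs')
    rw [List.flatMap_cons, QStep.run_append,
      run_groverRun _ _ _ _ _ _ (hy s List.mem_cons_self) (hc s List.mem_cons_self), ih hl.2]
    · congr 2 <;>
      · funext s'
        by_cases hs : s' = s
        · subst hs; simp [hl.1]
        · simp [hs]
    · intro s' hs'
      rw [Function.update_of_ne (hne s' hs'), hy s' (List.mem_cons_of_mem _ hs')]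
    · intro s' hs'
      rw [Function.update_of_ne (hne s' hs'), hc s' (List.mem_cons_of_mem _ hs')]

theorem single_start_eq_embed [NeZero n] (p : Fin m → Fin n) (r : Fin reps → Fin (maxIter n)) :
    (Pi.single (fixedSeedAlg p r).start 1 : QBasis n (Work n m) → ℂ)
      = embed (productState (fun _ _ => false) (fun _ _ _ => false)
          fun _ => Pi.single ⟨0, Nat.succ_pos _⟩ 1) := by
  classical
  funext b
  obtain ⟨i, z, t, d, y⟩ := b
  have hprod : (∏ s : Fin reps, if d s = ⟨0, Nat.succ_pos _⟩ then (1 : ℂ) else 0)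
      = if d = fun _ => ⟨0, Nat.succ_pos _⟩ then 1 else 0 := by
    simp only [Finset.prod_ite_zero, Finset.prod_const_one, Finset.mem_univ,
      true_implies, funext_iff]
  simp only [embed, productState, fixedSeedAlg, Pi.single_apply, hprod, Prod.mk.injEq,
    Work.mk.injEq, ← funext_iff (f := y)]
  split_ifs <;> tauto

theorem productState_maskStored (X M : Fin (sizeI n) → Fin m → Bool)
    (y : Fin reps → Fin (sizeJ n) → Fin m → Bool) (c : Fin reps → Fin (sizeJ n) → ℂ) :
    (fun w : Work n m => productState X y c (maskStored M w))
      = productState (fun i k => xor (X i k) (M i k)) y c := by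
  funext w
  simp only [productState, maskStored]
  congr 1
  simp only [eq_iff_iff, and_congr_left_iff, funext_iff]
  intro _
  refine forall_congr' fun i => forall_congr' fun k => ?_
  cases w.stored i k <;> cases X i k <;> cases M i k <;> simp

theorem finalState_fixedSeedAlg [NeZero n] (x : Fin n → Bool) (p : Fin m → Fin n)
    (r : Fin reps → Fin (maxIter n)) :
    (fixedSeedAlg p r).finalState x = embed (productState (trie x p) (fun _ => probe x p)
      fun s => groverAmplitude (Marked x p) (r s)) := by
  rw [QueryAlg.finalState_eq_run]
  have h := single_start_eq_embed p r
  calc _ = QStep.run x (storeStrings p ++ (List.finRange reps).flatMap fun s =>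
        groverRun p s (r s)) (Pi.single (fixedSeedAlg p r).start 1) := rfl
    _ = _ := by
      rw [h, QStep.run_append, run_storeStrings, productState_maskStored]
      simp only [Bool.false_xor]
      rw [run_groverRuns x p (fun s => r s) _ (List.nodup_finRange _) _ _ (fun _ _ => rfl)
        (fun _ _ => rfl)]
      simp

-- The final state is supported on basis states fixed by the measured indices `d`, the strings being
-- functions of `d`; the Born sum is therefore a sum over `d`.
open Classical in
theorem outputProb_fixedSeedAlg [NeZero n] (x : Fin n → Bool) (p : Fin m → Fin n)
    (r : Fin reps → Fin (maxIter n)) (a : Bool) :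
    (fixedSeedAlg p r).outputProb x a
      = ∑ d : Fin reps → Fin (sizeJ n), if decide (∃ s, Marked x p (d s)) = a then
          ∏ s, ‖groverAmplitude (Marked x p) (r s) (d s)‖ ^ 2 else 0 := by
  rw [QueryAlg.outputProb, finalState_fixedSeedAlg]
  symm
  let e : (Fin reps → Fin (sizeJ n)) → QBasis n (Work n m) := fun d =>
    (0, false, ⟨trie x p, d, fun s => probe x p (d s)⟩)
  refine Fintype.sum_of_injective e ?_ _ _ ?_ ?_
  · intro d d' h
    exact congrArg (fun b => b.2.2.index) h
  · rintro ⟨i, z, w⟩ hb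
    have : embed (productState (trie x p) (fun _ => probe x p)
        fun s => groverAmplitude (Marked x p) (r s)) (i, z, w) = 0 := by
      simp only [embed, productState]
      rw [ite_eq_right_iff]
      rintro ⟨rfl, rfl⟩
      rw [ite_eq_right_iff]
      rintro ⟨h1, h2⟩
      exact absurd ⟨w.index, by simp only [e, ← h1, ← h2]⟩ hb
    rw [this]
    simp
  · intro d
    have h1 : (fixedSeedAlg p r).answer (e d) = decide (∃ s, Marked x p (d s)) := rfl
    rw [h1]
    congr 1
    simp [embed, productState, e, Finset.prod_pow]

theorem outputProb_true_eq_zero [NeZero n] (x : Fin n → Bool) (p : Fin m → Fin n)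
    (r : Fin reps → Fin (maxIter n)) (h : ∀ α, ¬ Marked x p α) :
    (fixedSeedAlg p r).outputProb x true = 0 := by
  simp [outputProb_fixedSeedAlg, h]

-- "No repetition hits" is a product condition on `d`, so the sum of products factors: the
-- repetitions fail independently.
open Classical in
theorem outputProb_false_eq_prod [NeZero n] (x : Fin n → Bool) (p : Fin m → Fin n)
    (r : Fin reps → Fin (maxIter n)) :
    (fixedSeedAlg p r).outputProb x false
      = ∏ s, ∑ α with ¬ Marked x p α, ‖groverAmplitude (Marked x p) (r s) α‖ ^ 2 := by
  rw [outputProb_fixedSeedAlg, Finset.prod_univ_sum, ← Finset.sum_filter]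
  refine Finset.sum_congr ?_ fun _ _ => rfl
  ext d
  simp [Fintype.mem_piFinset]

/-! ### Grover search as a rotation, with a random number of iterations. -/

-- The amplitude vectors constant on marked and on unmarked elements form an invariant plane. The
-- term with factor `2 / N` is twice the mean after the sign flip.
open Classical in
theorem groverStep_apply {N t : ℕ} (marked : Fin N → Prop)
    (ht : (Finset.univ.filter marked).card = t) (a b : ℂ) :
    groverStep marked (fun α => if marked α then a else b)
      = fun α => if marked α then 2 / N * ((N - t) * b - t * a) + a
          else 2 / N * ((N - t) * b - t * a) - b := by
  have hcard : ((Finset.univ.filter fun α => ¬ marked α).card : ℂ) = N - t := by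
    have := Finset.card_filter_add_card_filter_not (s := (Finset.univ : Finset (Fin N))) marked
    rw [ht, Finset.card_univ, Fintype.card_fin] at this
    exact eq_sub_of_add_eq' (by exact_mod_cast this)
  funext α
  rw [groverStep, diffusionUnitary_mulVec]
  have h : ∀ β, (if marked β then -(if marked β then a else b) else if marked β then a else b)
      = if marked β then -a else b := by
    intro β
    split_ifs <;> rfl
  simp only [h, Finset.sum_ite, Finset.sum_const, nsmul_eq_mul, ht, hcard]
  split_ifs <;> ring

open Classical in
/-- If `t = N sin² θ` of the `N` elements are marked, then `r` Grover iterations turn the uniform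
superposition into `sin ((2 r + 1) θ) |marked⟩ + cos ((2 r + 1) θ) |unmarked⟩`. -/
theorem groverAmplitude_eq {N t : ℕ} (marked : Fin N → Prop)
    (ht : (Finset.univ.filter marked).card = t) (θ : ℝ) (hN : 0 < N)
    (hθ : Real.sin θ ^ 2 = t / N) (hs : Real.sin θ ≠ 0) (hc : Real.cos θ ≠ 0) (r : ℕ) :
    groverAmplitude marked r = fun α => if marked α
      then ((Real.sin ((2 * r + 1) * θ) / (√N * Real.sin θ) : ℝ) : ℂ)
      else ((Real.cos ((2 * r + 1) * θ) / (√N * Real.cos θ) : ℝ) : ℂ) := by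
  have hN' : (N : ℝ) ≠ 0 := by positivity
  have hsN : √(N : ℝ) ≠ 0 := by positivity
  induction r with
  | zero =>
    funext α
    simp only [groverAmplitude, Function.iterate_zero, id]
    have h1 : Real.sin ((2 * ((0 : ℕ) : ℝ) + 1) * θ) / (√N * Real.sin θ) = 1 / √N := by
      simp only [Nat.cast_zero, mul_zero, zero_add, one_mul]
      field_simp
    have h2 : Real.cos ((2 * ((0 : ℕ) : ℝ) + 1) * θ) / (√N * Real.cos θ) = 1 / √N := by
      simp only [Nat.cast_zero, mul_zero, zero_add, one_mul]
      field_simp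
    rw [h1, h2, ite_self]
    push_cast
    rfl
  | succ r ih =>
    rw [groverAmplitude, Function.iterate_succ_apply', ← groverAmplitude, ih,
      groverStep_apply marked ht]
    have htN : (t : ℝ) = N * Real.sin θ ^ 2 := by rw [hθ]; field_simp
    have hcN : (N : ℝ) - t = N * Real.cos θ ^ 2 := by rw [htN, Real.cos_sq']; ring
    have hsucc : (2 * ((r + 1 : ℕ) : ℝ) + 1) * θ = (2 * r + 1) * θ + 2 * θ := by
      push_cast; ring
    rw [hsucc]
    set φ := (2 * (r : ℝ) + 1) * θ
    -- Twice the mean equals `2 cos (φ + θ) / √N`; inserting it in both branches rotates the angle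
    -- by `2 θ`.
    have hmean : 2 / (N : ℝ) * ((N - t) * (Real.cos φ / (√N * Real.cos θ))
        - t * (Real.sin φ / (√N * Real.sin θ)))
        = 2 * (Real.cos θ * Real.cos φ - Real.sin θ * Real.sin φ) / √N := by
      rw [hcN, htN]
      field_simp
    have hmeanC : (2 / (N : ℂ) * ((N - t) * ((Real.cos φ / (√N * Real.cos θ) : ℝ) : ℂ)
        - t * ((Real.sin φ / (√N * Real.sin θ) : ℝ) : ℂ)))
        = ((2 * (Real.cos θ * Real.cos φ - Real.sin θ * Real.sin φ) / √N : ℝ) : ℂ) := by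
      rw [← hmean]
      push_cast
      ring
    have hsq := Real.sin_sq_add_cos_sq θ
    rw [hmeanC]
    funext α
    split_ifs
    · rw [← Complex.ofReal_add]
      congr 1
      rw [Real.sin_add, Real.sin_two_mul, Real.cos_two_mul]
      field_simp
      linear_combination (-2 * Real.sin φ) * hsq
    · rw [← Complex.ofReal_sub]
      congr 1
      rw [Real.cos_add, Real.sin_two_mul, Real.cos_two_mul]
      field_simp
      ring

/-- Telescopes, by `2 sin 2θ cos (2 (2r + 1) θ) = sin (4 (r + 1) θ) - sin (4 r θ)`. -/
theorem four_mul_sin_mul_sum_cos_sq (θ : ℝ) (M : ℕ) :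
    4 * Real.sin (2 * θ) * ∑ r ∈ Finset.range M, Real.cos ((2 * r + 1) * θ) ^ 2
      = 2 * M * Real.sin (2 * θ) + Real.sin (4 * M * θ) := by
  induction M with
  | zero => simp
  | succ M ih =>
    rw [Finset.sum_range_succ, mul_add, ih, Real.cos_sq]
    have h1 : 4 * ((M + 1 : ℕ) : ℝ) * θ = 2 * ((2 * M + 1) * θ) + 2 * θ := by push_cast; ring
    have h2 : 4 * (M : ℝ) * θ = 2 * ((2 * M + 1) * θ) - 2 * θ := by ring
    rw [h1, h2, Real.sin_add, Real.sin_sub]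
    push_cast
    ring

open Classical in
/-- The expected probability that a Grover run finds no marked element. -/
theorem sum_groverAmplitude_not_marked_le {N M : ℕ} (marked : Fin N → Prop)
    (hex : ∃ α, marked α) (hM : √(N : ℝ) ≤ M) :
    ∑ r : Fin M, ∑ α with ¬ marked α, ‖groverAmplitude marked r α‖ ^ 2 ≤ 3 / 4 * (M : ℝ) := by
  -- If everything is marked, `cos θ = 0` and the rotation formula does not apply, but there is
  -- nothing to sum.
  by_cases hall : ∀ α, marked α
  · simp only [hall, not_true_eq_false, Finset.filter_false, Finset.sum_empty, Finset.sum_const_zero]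
    positivity
  push Not at hall
  obtain ⟨α₀, hα₀⟩ := hex
  obtain ⟨β₀, hβ₀⟩ := hall
  have hN : 0 < N := α₀.pos
  obtain ⟨t, ht⟩ : ∃ t, (Finset.univ.filter marked).card = t := ⟨_, rfl⟩
  obtain ⟨q, hq⟩ : ∃ q, (Finset.univ.filter fun α => ¬ marked α).card = q := ⟨_, rfl⟩
  have htq : t + q = N := by
    have := Finset.card_filter_add_card_filter_not (s := (Finset.univ : Finset (Fin N))) marked
    rw [ht, hq, Finset.card_univ, Fintype.card_fin] at this
    exact this
  have ht0 : 0 < t := by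
    rw [← ht]; exact Finset.card_pos.2 ⟨α₀, by simpa using hα₀⟩
  have hq0 : 0 < q := by
    rw [← hq]; exact Finset.card_pos.2 ⟨β₀, by simpa using hβ₀⟩
  have htqR : (t : ℝ) + q = N := by exact_mod_cast htq
  have htR : (1 : ℝ) ≤ t := by exact_mod_cast ht0
  have hqR : (1 : ℝ) ≤ q := by exact_mod_cast hq0
  have hNR : (0 : ℝ) < N := by exact_mod_cast hN
  set θ := Real.arcsin √(t / N)
  have hle : (t : ℝ) / N ≤ 1 := by rw [div_le_one hNR]; linarith
  have hsin : Real.sin θ = √(t / N) :=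
    Real.sin_arcsin (by linarith [Real.sqrt_nonneg ((t : ℝ) / N)]) (Real.sqrt_le_one.2 hle)
  have hsin2 : Real.sin θ ^ 2 = t / N := by rw [hsin, Real.sq_sqrt (by positivity)]
  have hcos2 : Real.cos θ ^ 2 = q / N := by
    rw [Real.cos_sq', hsin2, ← htqR]
    field_simp
    ring
  have hs : 0 < Real.sin θ := by rw [hsin]; positivity
  have hc : 0 < Real.cos θ := by
    refine lt_of_le_of_ne (Real.cos_arcsin_nonneg _) fun h => ?_
    rw [← h] at hcos2
    have : (0 : ℝ) < q / N := by positivity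
    linarith
  have hsum : ∀ r : ℕ, ∑ α with ¬ marked α, ‖groverAmplitude marked r α‖ ^ 2
      = Real.cos ((2 * r + 1) * θ) ^ 2 := by
    intro r
    rw [groverAmplitude_eq marked ht θ hN hsin2 hs.ne' hc.ne' r]
    have : ∀ α ∈ Finset.univ.filter (fun α => ¬ marked α),
        ‖(if marked α then ((Real.sin ((2 * r + 1) * θ) / (√N * Real.sin θ) : ℝ) : ℂ)
          else ((Real.cos ((2 * r + 1) * θ) / (√N * Real.cos θ) : ℝ) : ℂ))‖ ^ 2
        = (Real.cos ((2 * r + 1) * θ) / (√N * Real.cos θ)) ^ 2 := by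
      intro α hα
      rw [if_neg (Finset.mem_filter.1 hα).2, Complex.norm_real, Real.norm_eq_abs, sq_abs]
    rw [Finset.sum_congr rfl this, Finset.sum_const, hq, nsmul_eq_mul, div_pow, mul_pow,
      Real.sq_sqrt hNR.le, hcos2]
    field_simp
  simp only [hsum]
  rw [Fin.sum_univ_eq_sum_range (fun r => Real.cos ((2 * r + 1) * θ) ^ 2)]
  have key := four_mul_sin_mul_sum_cos_sq θ M
  have hsin2θ : 0 < Real.sin (2 * θ) := by rw [Real.sin_two_mul]; positivity
  have hMN : (N : ℝ) ≤ M ^ 2 := by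
    rw [← Real.sq_sqrt hNR.le]
    exact pow_le_pow_left₀ (Real.sqrt_nonneg _) hM 2
  -- `sin² 2θ = 4 t q / N²`, where `4 t q ≥ t + q = N` because `t, q ≥ 1`; and `M² ≥ N`.
  have hMs : 1 ≤ M * Real.sin (2 * θ) := by
    have h1 : 1 ≤ (M * Real.sin (2 * θ)) ^ 2 := by
      have h2 : (M * Real.sin (2 * θ)) ^ 2 = M ^ 2 * (4 * (t / N) * (q / N)) := by
        rw [Real.sin_two_mul, ← hsin2, ← hcos2]; ring
      rw [h2]
      have h3 : 1 ≤ (N : ℝ) * (4 * (t / N) * (q / N)) := by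
        have : (N : ℝ) * (4 * (t / N) * (q / N)) = 4 * t * q / N := by field_simp
        rw [this, le_div_iff₀ hNR]
        nlinarith
      have h4 : (0 : ℝ) ≤ 4 * (t / N) * (q / N) := by positivity
      nlinarith
    have h5 : 0 ≤ M * Real.sin (2 * θ) := by positivity
    nlinarith
  have hle1 := Real.sin_le_one (4 * M * θ)
  -- The left side is at most `2 M sin 2θ + 1`, hence at most `3 M sin 2θ`.
  have : 4 * Real.sin (2 * θ) * ∑ r ∈ Finset.range M, Real.cos ((2 * r + 1) * θ) ^ 2
      ≤ 4 * Real.sin (2 * θ) * (3 / 4 * M) := by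
    rw [key]; linarith
  exact le_of_mul_le_mul_left this (by positivity)

theorem sizeJ_le_maxIter (n : ℕ) : √(sizeJ n : ℝ) ≤ maxIter n := Nat.le_ceil _

/-- If some element of the search space is marked, all repetitions miss with probability at
most `1 / 4`. -/
theorem sum_outputProb_false_le [NeZero n] (x : Fin n → Bool) (p : Fin m → Fin n)
    (h : ∃ α, Marked x p α) :
    ∑ r : Fin reps → Fin (maxIter n), (fixedSeedAlg p r).outputProb x false
      ≤ 1 / 4 * Fintype.card (Fin reps → Fin (maxIter n)) := by
  classical
  simp only [outputProb_false_eq_prod]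
  rw [← Fintype.piFinset_univ, ← Finset.prod_univ_sum (fun _ => Finset.univ)
    (fun (_ : Fin reps) (r : Fin (maxIter n)) =>
      ∑ α with ¬ Marked x p α, ‖groverAmplitude (Marked x p) r α‖ ^ 2)]
  rw [Finset.prod_const, Finset.card_univ, Fintype.card_fin, Fintype.card_fun, Fintype.card_fin,
    Fintype.card_fin]
  calc _ ≤ (3 / 4 * (maxIter n : ℝ)) ^ reps :=
        pow_le_pow_left₀ (by positivity)
          (sum_groverAmplitude_not_marked_le _ h (sizeJ_le_maxIter n)) _
    _ ≤ _ := by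
      rw [mul_pow]
      push_cast
      gcongr
      -- `(3/4)^9 ≤ 1/4`.
      norm_num [reps]

end MeetInTheMiddle

/-! ### The language as a family of reflection symmetries. -/

theorem List.getElem?_eq_of_reverse_eq {α : Type*} {l : List α} (h : l.reverse = l) {i j : ℕ}
    (hij : i + j + 1 = l.length) : l[i]? = l[j]? := by
  rw [← h, List.getElem?_reverse (by omega), h]
  congr 1
  omega

/-- The words `u uʳ v vʳ` with `2 |u| = c + 1` are the words that are invariant under the reflection
`a ↦ c - a` of `ℤ / n`. -/
theorem exists_reflection_of_mem_LRev {n : ℕ} [NeZero n] (x : Fin n → Bool)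
    (h : List.ofFn x ∈ LRev) :
    ∃ k l : ℕ, 1 ≤ k ∧ 1 ≤ l ∧ 2 * k + 2 * l = n ∧
      ∀ a, x (Fin.ofNat n (2 * k - 1) - a) = x a := by
  obtain ⟨u, v, hu, hv, huv⟩ := h
  have hk := List.length_pos_iff.2 hu
  have hl := List.length_pos_iff.2 hv
  have hn : 2 * u.length + 2 * v.length = n := by
    have := congrArg List.length huv
    simp at this
    omega
  have hx : ∀ a : Fin n, some (x a) = (u ++ u.reverse ++ v ++ v.reverse)[(a : ℕ)]? := by
    intro a
    rw [← huv]
    simp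
  refine ⟨u.length, v.length, hk, hl, hn, fun a => ?_⟩
  have hc : ((Fin.ofNat n (2 * u.length - 1) : Fin n) : ℕ) = 2 * u.length - 1 := by
    rw [Fin.val_ofNat, Nat.mod_eq_of_lt (by omega)]
  set c : Fin n := Fin.ofNat n (2 * u.length - 1)
  have ha := a.isLt
  have hpu : (u ++ u.reverse).reverse = u ++ u.reverse := by simp
  have hpv : (v ++ v.reverse).reverse = v ++ v.reverse := by simp
  apply Option.some_injective
  rw [hx, hx, List.append_assoc]
  have hlu : (u ++ u.reverse).length = 2 * u.length := by simp; omega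
  have hlv : (v ++ v.reverse).length = 2 * v.length := by simp; omega
  generalize u ++ u.reverse = P at hpu hlu ⊢
  generalize v ++ v.reverse = Q at hpv hlv ⊢
  -- For `a ≤ c` the reflection stays inside the palindrome `u uʳ`; for `a > c` it wraps around to
  -- `n + c - a`, inside `v vʳ`.
  rcases le_or_gt a c with hac | hac
  · rw [Fin.sub_val_of_le hac, hc]
    have : (a : ℕ) ≤ 2 * u.length - 1 := by rw [← hc]; exact hac
    rw [List.getElem?_append_left (by omega), List.getElem?_append_left (by omega)]
    exact List.getElem?_eq_of_reverse_eq hpu (by omega)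
  · have hval : ((c - a : Fin n) : ℕ) = n + c - a := by
      rw [Fin.coe_sub_iff_lt.2 hac]
    have : 2 * u.length - 1 < (a : ℕ) := by rw [← hc]; exact hac
    rw [hval, hc, List.getElem?_append_right (by omega),
      List.getElem?_append_right (by omega)]
    exact List.getElem?_eq_of_reverse_eq hpv (by omega)

theorem mem_LRev_of_reflection {n : ℕ} [NeZero n] (x : Fin n → Bool) (k l : ℕ) (hk : 1 ≤ k)
    (hl : 1 ≤ l) (hn : 2 * k + 2 * l = n) (h : ∀ a, x (Fin.ofNat n (2 * k - 1) - a) = x a) :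
    List.ofFn x ∈ LRev := by
  have hc : ((Fin.ofNat n (2 * k - 1) : Fin n) : ℕ) = 2 * k - 1 := by
    rw [Fin.val_ofNat, Nat.mod_eq_of_lt (by omega)]
  set c : Fin n := Fin.ofNat n (2 * k - 1)
  have hlow : ∀ (i j : ℕ) (hi : i < n) (hj : j < n), i + j = 2 * k - 1 → x ⟨i, hi⟩ = x ⟨j, hj⟩ := by
    intro i j hi hj hij
    rw [← h ⟨j, hj⟩]
    congr 1
    ext
    have hle : (⟨j, hj⟩ : Fin n) ≤ c := by rw [Fin.le_def, hc]; simp; omega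
    rw [Fin.sub_val_of_le hle, hc]
    simp
    omega
  have hhigh : ∀ (i j : ℕ) (hi : i < n) (hj : j < n), i + j = n + (2 * k - 1) →
      x ⟨i, hi⟩ = x ⟨j, hj⟩ := by
    intro i j hi hj hij
    rw [← h ⟨j, hj⟩]
    congr 1
    ext
    have hlt : c < (⟨j, hj⟩ : Fin n) := by rw [Fin.lt_def, hc]; simp; omega
    rw [Fin.coe_sub_iff_lt.2 hlt, hc]
    simp
    omega
  -- `u` and `v` are the first halves of the blocks that start at `0` and at `2k`.
  refine ⟨List.ofFn fun i : Fin k => x ⟨i, by omega⟩,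
    List.ofFn fun i : Fin l => x ⟨2 * k + i, by omega⟩, ?_, ?_, ?_⟩
  · simp; omega
  · simp; omega
  · apply List.ext_getElem
    · simp; omega
    · intro i hi hi'
      simp only [List.length_ofFn] at hi
      simp only [List.getElem_append, List.length_append, List.length_ofFn, List.length_reverse,
        List.getElem_reverse, List.getElem_ofFn]
      split_ifs
      · rfl
      · exact hlow _ _ _ _ (by omega)
      · congr 2; omega
      · exact hhigh _ _ _ _ (by omega)

/-- If all words of `LRev` are far from `x`, then `x` is far from invariant under the reflection
that belongs to `|u| = k`. -/
theorem RevPromise.le_card_reflection_ne {n : ℕ} [NeZero n] {ε : ℝ} {x : Fin n → Bool}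
    (hx : RevPromise n ε x) (hmem : List.ofFn x ∉ LRev) (k l : ℕ) (hk : 1 ≤ k) (hl : 1 ≤ l)
    (hn : 2 * k + 2 * l = n) :
    ε * n ≤ (Finset.univ.filter fun a => x (Fin.ofNat n (2 * k - 1) - a) ≠ x a).card := by
  set c : Fin n := Fin.ofNat n (2 * k - 1)
  -- `y` copies to both points of each orbit `{a, c - a}` the letter of the smaller one; it can
  -- differ from `x` only where `x` breaks the symmetry.
  let y : Fin n → Bool := fun a => x (min a (c - a))
  have hy : List.ofFn y ∈ LRev := by
    refine mem_LRev_of_reflection y k l hk hl hn fun a => ?_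
    change x (min (c - a) (c - (c - a))) = x (min a (c - a))
    rw [sub_sub_cancel, min_comm]
  refine (hx hmem y hy).trans ?_
  rw [hammingDist]
  norm_cast
  refine Finset.card_le_card fun a => ?_
  simp only [Finset.mem_filter, Finset.mem_univ, true_and]
  intro hne
  rcases min_choice a (c - a) with hm | hm
  · exact absurd (by simp only [y, hm]) hne
  · simpa only [y, hm] using Ne.symm hne

/-! ### Probability of a match over the random offsets. -/

namespace MeetInTheMiddle

variable {n m : ℕ}

theorem sizeI_pos [NeZero n] : 0 < sizeI n := by
  rw [sizeI, Nat.floor_pos]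
  exact Real.one_le_rpow (by exact_mod_cast NeZero.one_le) (by norm_num)

theorem sizeI_le_rpow (n : ℕ) : (sizeI n : ℝ) ≤ (n : ℝ) ^ (1 / 3 : ℝ) :=
  Nat.floor_le (by positivity)

theorem sizeI_le [NeZero n] : sizeI n ≤ n := by
  have h : (sizeI n : ℝ) ≤ n := (sizeI_le_rpow n).trans
    (Real.rpow_le_self_of_one_le (by exact_mod_cast NeZero.one_le) (by norm_num))
  exact_mod_cast h

/-- Bounds the number of pairs in the union bound: `L (⌊n / L⌋ + 1) ≤ n + L`. -/
theorem sizeI_mul_sizeJ_le [NeZero n] : sizeI n * sizeJ n ≤ 2 * n := by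
  have h1 := Nat.mul_div_le n (sizeI n)
  have h2 := sizeI_le (n := n)
  rw [sizeJ, mul_add]
  omega

theorem ofNat_add_ofNat [NeZero n] (i j : ℕ) :
    Fin.ofNat n i + Fin.ofNat n j = Fin.ofNat n (i + j) := by
  ext
  simp [Fin.val_add]

/-- `α` and `i` are quotient and remainder of `2k - 1` by `L`; the reflection maps `α L + p` to `i -
p`, whatever the offset. -/
theorem exists_marked_of_mem_LRev [NeZero n] (x : Fin n → Bool) (p : Fin m → Fin n)
    (h : List.ofFn x ∈ LRev) : ∃ α, Marked x p α := by
  obtain ⟨k, l, hk, hl, hn, hx⟩ := exists_reflection_of_mem_LRev x h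
  have hmod := Nat.mod_add_div' (2 * k - 1) (sizeI n)
  refine ⟨⟨(2 * k - 1) / sizeI n, Nat.lt_succ_of_le (Nat.div_le_div_right (by omega))⟩,
    ⟨(2 * k - 1) % sizeI n, Nat.mod_lt _ sizeI_pos⟩, ⟨k, l, hk, hl, hn, ?_⟩, ?_⟩
  · dsimp only
    omega
  · funext q
    simp only [trie, probe]
    rw [← hx]
    congr 1
    nth_rewrite 1 [← hmod]
    rw [← ofNat_add_ofNat]
    abel

/-- The offsets are independent, which gives the `m`-th power. For one offset `q`, the bijection `q
↦ b + q` identifies mismatches with positions where the reflection fails. -/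
theorem card_trie_eq_probe_le [NeZero n] {ε : ℝ} {x : Fin n → Bool} (hx : RevPromise n ε x)
    (hmem : List.ofFn x ∉ LRev) (i : Fin (sizeI n)) (α : Fin (sizeJ n))
    (hs : Symmetric n i ((α : ℕ) * sizeI n)) :
    ((Finset.univ.filter fun p : Fin m → Fin n => trie x p i = probe x p α).card : ℝ)
      ≤ ((1 - ε) * n) ^ m := by
  obtain ⟨k, l, hk, hl, hn, hij⟩ := hs
  set a : Fin n := Fin.ofNat n i
  set b : Fin n := Fin.ofNat n ((α : ℕ) * sizeI n)
  have hab : a + b = Fin.ofNat n (2 * k - 1) := by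
    rw [ofNat_add_ofNat]
    congr 1
    omega
  have hpi : (Finset.univ.filter fun p : Fin m → Fin n => trie x p i = probe x p α)
      = Fintype.piFinset fun _ => Finset.univ.filter fun q => x (a - q) = x (b + q) := by
    ext p
    simp [Fintype.mem_piFinset, funext_iff, trie, probe, a, b]
  rw [hpi, Fintype.card_piFinset_const]
  push_cast
  refine pow_le_pow_left₀ (by positivity) ?_ m
  have hfar := hx.le_card_reflection_ne hmem k l hk hl hn
  have hbij : (Finset.univ.filter fun c => x (Fin.ofNat n (2 * k - 1) - c) ≠ x c).card
      = (Finset.univ.filter fun q => ¬ x (a - q) = x (b + q)).card := by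
    symm
    refine Finset.card_equiv (Equiv.addLeft b) fun q => ?_
    have : a + b - (b + q) = a - q := by abel
    simp only [Finset.mem_filter, Finset.mem_univ, true_and, Equiv.coe_addLeft, ← hab, this, ne_eq]
  have hsum := Finset.card_filter_add_card_filter_not (s := (Finset.univ : Finset (Fin n)))
    fun q => x (a - q) = x (b + q)
  rw [← hbij, Finset.card_univ, Fintype.card_fin] at hsum
  have hsumR : ((Finset.univ.filter fun q => x (a - q) = x (b + q)).card : ℝ)
      + (Finset.univ.filter fun c => x (Fin.ofNat n (2 * k - 1) - c) ≠ x c).card = n := by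
    exact_mod_cast hsum
  linarith

theorem two_mul_mul_pow_numOffsets_le {ε : ℝ} (hε : 0 < ε) (hε1 : ε < 1) (hn : 4 ≤ n) :
    2 * (n : ℝ) * (1 - ε) ^ numOffsets n ε ≤ 1 / 4 := by
  have hn4 : (4 : ℝ) ≤ n := by exact_mod_cast hn
  have hm : 2 / ε * Real.logb 2 n ≤ numOffsets n ε := Nat.le_ceil _
  set ℓ := Real.logb 2 n
  have hnℓ : (n : ℝ) = Real.exp (ℓ * Real.log 2) := by
    rw [show ℓ = Real.log n / Real.log 2 from rfl,
      div_mul_cancel₀ _ (Real.log_pos one_lt_two).ne', Real.exp_log (by positivity)]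
  have hℓ : 2 ≤ ℓ := by
    rw [Real.le_logb_iff_rpow_le one_lt_two (by positivity)]
    norm_num
    exact hn
  have hpow : (1 - ε) ^ numOffsets n ε ≤ Real.exp (-(2 * ℓ)) := by
    calc (1 - ε) ^ numOffsets n ε ≤ Real.exp (-ε) ^ numOffsets n ε :=
          pow_le_pow_left₀ (by linarith) (Real.one_sub_le_exp_neg ε) _
      _ = Real.exp (numOffsets n ε * -ε) := (Real.exp_nat_mul _ _).symm
      _ ≤ _ := by
        apply Real.exp_le_exp.2
        have : 2 / ε * ℓ * ε = 2 * ℓ := by field_simp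
        nlinarith
  have hlog : Real.log 2 ≤ 0.7 := by linarith [Real.log_two_lt_d9]
  calc 2 * (n : ℝ) * (1 - ε) ^ numOffsets n ε ≤ 2 * n * Real.exp (-(2 * ℓ)) := by gcongr
    _ = 2 * Real.exp (ℓ * Real.log 2 - 2 * ℓ) := by
      rw [mul_assoc, hnℓ, ← Real.exp_add, sub_eq_add_neg]
    -- `n ≥ 4` gives `ℓ ≥ 2`, and `log 2 ≤ 0.7`, so the exponent is at most `-1.3 ℓ ≤ -2.6`.
    _ ≤ 2 * Real.exp (-(2.6 : ℝ)) := by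
      gcongr
      nlinarith
    _ ≤ 1 / 4 := by
      have h1 : (2.7 : ℝ) ≤ Real.exp 1 := by linarith [Real.exp_one_gt_d9]
      have h2 : (8 : ℝ) ≤ Real.exp 2.6 := by
        have h3 : Real.exp 2.6 = Real.exp 1 * Real.exp 1 * Real.exp 0.6 := by
          rw [← Real.exp_add, ← Real.exp_add]; norm_num
        have h4 : (1.6 : ℝ) ≤ Real.exp 0.6 := by linarith [Real.add_one_le_exp (0.6 : ℝ)]
        rw [h3]
        nlinarith [mul_le_mul h1 h1 (by norm_num) (by positivity)]
      rw [Real.exp_neg, ← div_eq_mul_inv, div_le_iff₀ (by positivity)]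
      linarith

open Classical in
/-- For an input far from `LRev`, the probability over the offsets that some element of the search
space is marked. -/
theorem card_exists_marked_le [NeZero n] {ε : ℝ} (hε : 0 < ε) (hε1 : ε < 1) {x : Fin n → Bool}
    (hx : RevPromise n ε x) (hmem : List.ofFn x ∉ LRev) :
    ((Finset.univ.filter fun p : Fin (numOffsets n ε) → Fin n => ∃ α, Marked x p α).card : ℝ)
      ≤ 1 / 4 * (n : ℝ) ^ numOffsets n ε := by
  -- With no admissible pair (for instance if `n` is odd) nothing is ever marked. An admissible pair
  -- forces `n ≥ 4`, which the numerical bound requires.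
  by_cases hsym : ∃ (i : Fin (sizeI n)) (α : Fin (sizeJ n)), Symmetric n i ((α : ℕ) * sizeI n)
  swap
  · push Not at hsym
    have : ∀ p : Fin (numOffsets n ε) → Fin n, ¬ ∃ α, Marked x p α :=
      fun p ⟨α, i, hs, _⟩ => hsym i α hs
    simp only [this, Finset.filter_false, Finset.card_empty, Nat.cast_zero]
    positivity
  have hn : 4 ≤ n := by
    obtain ⟨i, α, k, l, hk, hl, hn, -⟩ := hsym
    omega
  let S : Finset (Fin (sizeI n) × Fin (sizeJ n)) :=
    Finset.univ.filter fun s => Symmetric n s.1 ((s.2 : ℕ) * sizeI n)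
  have hsub : (Finset.univ.filter fun p : Fin (numOffsets n ε) → Fin n => ∃ α, Marked x p α)
      ⊆ S.biUnion fun s => Finset.univ.filter fun p => trie x p s.1 = probe x p s.2 := by
    intro p hp
    obtain ⟨α, i, hs, h⟩ := (Finset.mem_filter.1 hp).2
    simp only [Finset.mem_biUnion, Finset.mem_filter, Finset.mem_univ, true_and, S]
    exact ⟨(i, α), hs, h⟩
  have hS : (S.card : ℝ) ≤ 2 * n := by
    have h1 : S.card ≤ sizeI n * sizeJ n := by
      simpa using Finset.card_le_univ S
    exact_mod_cast h1.trans sizeI_mul_sizeJ_le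
  have hpow : (0 : ℝ) ≤ ((1 - ε) * n) ^ numOffsets n ε :=
    pow_nonneg (mul_nonneg (by linarith) (by positivity)) _
  calc _ ≤ ∑ s ∈ S, ((Finset.univ.filter fun p : Fin (numOffsets n ε) → Fin n =>
          trie x p s.1 = probe x p s.2).card : ℝ) := by
        exact_mod_cast (Finset.card_le_card hsub).trans Finset.card_biUnion_le
    _ ≤ ∑ s ∈ S, ((1 - ε) * n) ^ numOffsets n ε :=
        Finset.sum_le_sum fun s hs =>
          card_trie_eq_probe_le hx hmem s.1 s.2 (Finset.mem_filter.1 hs).2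
    _ = S.card * ((1 - ε) * n) ^ numOffsets n ε := by rw [Finset.sum_const, nsmul_eq_mul]
    _ ≤ 2 * n * ((1 - ε) * n) ^ numOffsets n ε := by gcongr
    _ = 2 * n * (1 - ε) ^ numOffsets n ε * n ^ numOffsets n ε := by rw [mul_pow]; ring
    _ ≤ _ := by
      gcongr
      exact two_mul_mul_pow_numOffsets_le hε hε1 hn

theorem meetInTheMiddle_outputProb (n : ℕ) [NeZero n] (ε : ℝ) (x : Fin n → Bool) (a : Bool) :
    (meetInTheMiddle n ε).outputProb x a
      = (∑ p : Fin (numOffsets n ε) → Fin n, ∑ r : Fin reps → Fin (maxIter n),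
          (fixedSeedAlg p r).outputProb x a)
        / ((n : ℝ) ^ numOffsets n ε * Fintype.card (Fin reps → Fin (maxIter n))) := by
  have hcard : (Fintype.card ((Fin (numOffsets n ε) → Fin n) × (Fin reps → Fin (maxIter n))) : ℝ)
      = (n : ℝ) ^ numOffsets n ε * Fintype.card (Fin reps → Fin (maxIter n)) := by
    rw [Fintype.card_prod, Fintype.card_fun, Fintype.card_fin, Fintype.card_fin]
    push_cast
    rfl
  rw [← hcard, ← Fintype.sum_prod_type']
  rfl

theorem card_seeds_pos (n : ℕ) [NeZero n] (m : ℕ) :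
    (0 : ℝ) < (n : ℝ) ^ m * Fintype.card (Fin reps → Fin (maxIter n)) := by
  have hn : (0 : ℝ) < n := by exact_mod_cast NeZero.pos n
  have : Nonempty (Fin reps → Fin (maxIter n)) := ⟨fun _ => ⟨0, maxIter_pos n⟩⟩
  have : (0 : ℝ) < Fintype.card (Fin reps → Fin (maxIter n)) := by
    exact_mod_cast Fintype.card_pos
  positivity

theorem outputProb_false_le_of_mem [NeZero n] (ε : ℝ) {x : Fin n → Bool}
    (h : List.ofFn x ∈ LRev) : (meetInTheMiddle n ε).outputProb x false ≤ 1 / 4 := by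
  rw [meetInTheMiddle_outputProb, div_le_iff₀ (card_seeds_pos n _)]
  calc _ ≤ ∑ _p : Fin (numOffsets n ε) → Fin n,
        1 / 4 * (Fintype.card (Fin reps → Fin (maxIter n)) : ℝ) :=
        Finset.sum_le_sum fun p _ => sum_outputProb_false_le x p (exists_marked_of_mem_LRev x p h)
    _ = _ := by
      rw [Finset.sum_const, Finset.card_univ, Fintype.card_fun, Fintype.card_fin, Fintype.card_fin,
        nsmul_eq_mul]
      push_cast
      ring

theorem outputProb_true_le_of_notMem [NeZero n] {ε : ℝ} (hε : 0 < ε) (hε1 : ε < 1)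
    {x : Fin n → Bool} (hx : RevPromise n ε x) (hmem : List.ofFn x ∉ LRev) :
    (meetInTheMiddle n ε).outputProb x true ≤ 1 / 4 := by
  classical
  rw [meetInTheMiddle_outputProb, div_le_iff₀ (card_seeds_pos n _)]
  -- Only offsets with a false match can cause an error, and these are charged fully.
  have hp : ∀ p : Fin (numOffsets n ε) → Fin n,
      ∑ r : Fin reps → Fin (maxIter n), (fixedSeedAlg p r).outputProb x true
        ≤ if ∃ α, Marked x p α then (Fintype.card (Fin reps → Fin (maxIter n)) : ℝ) else 0 := by
    intro p
    split_ifs with h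
    · refine (Finset.sum_le_sum fun r _ => QueryAlg.outputProb_le_one _ _ _).trans ?_
      simp
    · push Not at h
      exact (Finset.sum_eq_zero fun r _ => outputProb_true_eq_zero x p r h).le
  refine (Finset.sum_le_sum fun p _ => hp p).trans ?_
  rw [← Finset.sum_filter, Finset.sum_const, nsmul_eq_mul, ← mul_assoc]
  gcongr
  exact card_exists_marked_le hε hε1 hx hmem

/-! ### The number of queries -/

theorem queries_readBit [NeZero n] (a : Work n m → Fin n) (τ : Equiv.Perm (Work n m)) :
    ((readBit a τ).map QStep.cost).sum = 2 := by
  simp [readBit, QStep.cost]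

theorem queries_flatMap {W ι : Type} [Fintype W] [DecidableEq W] (l : List ι)
    (f : ι → List (QStep n W)) :
    ((l.flatMap f).map QStep.cost).sum = (l.map fun i => ((f i).map QStep.cost).sum).sum := by
  induction l with
  | nil => rfl
  | cons i l ih => simp [ih]

theorem queries_storeStrings [NeZero n] (p : Fin m → Fin n) :
    ((storeStrings p).map QStep.cost).sum = sizeI n * (m * 2) := by
  simp [storeStrings, queries_flatMap, queries_readBit]

theorem queries_addSample [NeZero n] (p : Fin m → Fin n) (s : Fin reps) :
    ((addSample p s).map QStep.cost).sum = m * 2 := by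
  simp [addSample, queries_flatMap, queries_readBit]

theorem queries_groverRun [NeZero n] (p : Fin m → Fin n) (s : Fin reps) (r : ℕ) :
    ((groverRun p s r).map QStep.cost).sum = r * (4 * m) + 2 * m := by
  have hiter : ((groverIteration p s).map QStep.cost).sum = 4 * m := by
    simp only [groverIteration, List.map_append, List.sum_append, queries_addSample, List.map_cons,
      List.map_nil, List.sum_cons, List.sum_nil, QStep.cost]
    ring
  have hiters : ((List.replicate r (groverIteration p s)).flatten.map QStep.cost).sum
      = r * (4 * m) := by
    induction r with
    | zero => simp
    | succ r ih =>
      rw [List.replicate_succ, List.flatten_cons, List.map_append, List.sum_append, ih, hiter]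
      ring
  simp only [groverRun, List.map_append, List.sum_append, queries_addSample, hiters, List.map_cons,
    List.map_nil, List.sum_cons, List.sum_nil, QStep.cost]
  ring

theorem numQueries_fixedSeedAlg_le [NeZero n] (p : Fin m → Fin n)
    (r : Fin reps → Fin (maxIter n)) :
    ((fixedSeedAlg p r).numQueries : ℝ) ≤ (2 * sizeI n + 36 * √(sizeJ n : ℝ) + 18) * m := by
  have hq : (fixedSeedAlg p r).numQueries
      = sizeI n * (m * 2) + ∑ s, ((r s : ℕ) * (4 * m) + 2 * m) := by
    calc _ = (((storeStrings p) ++ (List.finRange reps).flatMap fun s =>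
          groverRun p s (r s)).map QStep.cost).sum := rfl
      _ = _ := by
        rw [List.map_append, List.sum_append, queries_storeStrings, queries_flatMap,
          ← List.ofFn_eq_map, List.sum_ofFn]
        simp only [queries_groverRun]
  -- The largest `r` is one less than the ceiling, so rounding up costs nothing.
  have hr : ∀ s, ((r s : ℕ) : ℝ) ≤ √(sizeJ n : ℝ) := by
    intro s
    have h1 : ((r s : ℕ) : ℝ) + 1 ≤ maxIter n := by exact_mod_cast (r s).isLt
    have h2 : (maxIter n : ℝ) < √(sizeJ n : ℝ) + 1 := Nat.ceil_lt_add_one (Real.sqrt_nonneg _)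
    linarith
  rw [hq]
  push_cast
  calc (sizeI n : ℝ) * (m * 2) + ∑ s : Fin reps, (((r s : ℕ) : ℝ) * (4 * m) + 2 * m)
      ≤ sizeI n * (m * 2) + ∑ _s : Fin reps, (√(sizeJ n : ℝ) * (4 * m) + 2 * m) := by
        gcongr with s
        exact hr s
    _ = _ := by
      rw [Finset.sum_const, Finset.card_univ, Fintype.card_fin, nsmul_eq_mul, reps]
      push_cast
      ring

theorem sqrt_sizeJ_le [NeZero n] : √(sizeJ n : ℝ) ≤ 2 * (n : ℝ) ^ (1 / 3 : ℝ) := by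
  have hn : (1 : ℝ) ≤ n := by exact_mod_cast NeZero.one_le
  set y := (n : ℝ) ^ (1 / 3 : ℝ)
  have hy : 1 ≤ y := Real.one_le_rpow hn (by norm_num)
  have hy3 : y ^ 3 = n := by
    rw [← Real.rpow_natCast, ← Real.rpow_mul (by positivity)]
    norm_num
  have hL : 0 < (sizeI n : ℝ) := by exact_mod_cast sizeI_pos
  have hL1 : 1 ≤ (sizeI n : ℝ) := by exact_mod_cast sizeI_pos (n := n)
  have hLy : y < sizeI n + 1 := Nat.lt_floor_add_one y
  have hdiv : ((n / sizeI n : ℕ) : ℝ) ≤ n / sizeI n := Nat.cast_div_le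
  -- Rounding down loses at most a factor 2: `y < L + 1 ≤ 2 L`.
  have h2 : (n : ℝ) / sizeI n ≤ 2 * y ^ 2 := by
    rw [div_le_iff₀ hL, ← hy3]
    nlinarith [sq_nonneg y]
  rw [Real.sqrt_le_left (by positivity), sizeJ]
  push_cast
  nlinarith

/-- For `n ≥ 2` the rounding is absorbed by `(1/ε) log₂ n ≥ 1`, and `3 / log 2 ≤ 5`. For `n = 1`
both sides vanish. -/
theorem numOffsets_le [NeZero n] {ε : ℝ} (hε : 0 < ε) (hε1 : ε < 1) :
    (numOffsets n ε : ℝ) ≤ 5 * (1 / ε * Real.log n) := by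
  rcases Nat.lt_or_ge 1 n with hn | hn
  · have hn2 : (2 : ℝ) ≤ n := by exact_mod_cast hn
    have hlog2 : 0.69 < Real.log 2 := by linarith [Real.log_two_gt_d9]
    have hlogn : Real.log 2 ≤ Real.log n := Real.log_le_log two_pos hn2
    have hceil : (numOffsets n ε : ℝ) < 2 / ε * Real.logb 2 n + 1 := by
      apply Nat.ceil_lt_add_one
      have : 0 ≤ Real.logb 2 n := Real.logb_nonneg one_lt_two (by linarith)
      positivity
    have hε' : 1 ≤ 1 / ε := by rw [le_div_iff₀ hε]; linarith
    have hlogb : 1 ≤ Real.logb 2 n := by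
      rw [Real.logb, le_div_iff₀ (by linarith)]; linarith
    have hlogb' : 3 * Real.logb 2 n ≤ 5 * Real.log n := by
      rw [Real.logb, mul_div_assoc', div_le_iff₀ (by linarith)]
      nlinarith
    have h1 : 1 ≤ 1 / ε * Real.logb 2 n := by nlinarith
    calc (numOffsets n ε : ℝ) ≤ 1 / ε * (3 * Real.logb 2 n) := by
          have : 2 / ε * Real.logb 2 n = 2 * (1 / ε * Real.logb 2 n) := by ring
          linarith
      _ ≤ 1 / ε * (5 * Real.log n) := by gcongr
      _ = _ := by ring
  · have : n = 1 := le_antisymm hn NeZero.one_le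
    subst this
    simp [numOffsets]

theorem queryComplexity_meetInTheMiddle_le (n : ℕ) [NeZero n] {ε : ℝ} (hε : 0 < ε) (hε1 : ε < 1) :
    ((meetInTheMiddle n ε).queryComplexity : ℝ)
      ≤ 460 * (1 / ε * (n : ℝ) ^ (1 / 3 : ℝ) * Real.log n) := by
  obtain ⟨σ, -, hσ⟩ := Finset.exists_mem_eq_sup (Finset.univ : Finset (meetInTheMiddle n ε).Seed)
    Finset.univ_nonempty fun s => ((meetInTheMiddle n ε).alg s).numQueries
  rw [RandQueryAlg.queryComplexity, hσ]
  have hn : (1 : ℝ) ≤ n := by exact_mod_cast NeZero.one_le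
  have hy : 1 ≤ (n : ℝ) ^ (1 / 3 : ℝ) := Real.one_le_rpow hn (by norm_num)
  have hlog : 0 ≤ Real.log n := Real.log_nonneg hn
  have hI := sizeI_le_rpow n
  have hJ := sqrt_sizeJ_le (n := n)
  calc ((fixedSeedAlg σ.1 σ.2).numQueries : ℝ)
      ≤ (2 * sizeI n + 36 * √(sizeJ n : ℝ) + 18) * numOffsets n ε :=
        numQueries_fixedSeedAlg_le _ _
    -- `92 = 2 + 36 · 2 + 18`, the last summand using `n^{1/3} ≥ 1`.
    _ ≤ (92 * (n : ℝ) ^ (1 / 3 : ℝ)) * (5 * (1 / ε * Real.log n)) := by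
        gcongr
        · linarith
        · exact numOffsets_le hε hε1
    _ = _ := by ring

end MeetInTheMiddle

theorem mainTheorem1 :
    ∃ C : ℝ, ∀ (n : ℕ) [NeZero n] (ε : ℝ), 0 < ε → ε < 1 →
      ((meetInTheMiddle n ε).queryComplexity : ℝ)
          ≤ C * (1 / ε * (n : ℝ) ^ (1 / 3 : ℝ) * Real.log n) ∧
      ∀ x : Fin n → Bool, RevPromise n ε x →
        (meetInTheMiddle n ε).outputProb x (!(REV n x)) ≤ 1 / 4 := by
  refine ⟨460, fun n _ ε hε hε1 =>
    ⟨MeetInTheMiddle.queryComplexity_meetInTheMiddle_le n hε hε1, fun x hx => ?_⟩⟩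
  by_cases hmem : List.ofFn x ∈ LRev
  · simpa [REV, hmem] using MeetInTheMiddle.outputProb_false_le_of_mem ε hmem
  · simpa [REV, hmem] using MeetInTheMiddle.outputProb_true_le_of_notMem hε hε1 hx hmem
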